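/- Let $N\ge 3$ be an integer and let $f\in C^2((0,\infty))$ satisfy $f(s)>0$ and $f'(s)>0$ for all $s>0$. Suppose that the limit $$q_f:=\lim_{s\to\infty}\frac{f'(s)^2}{f(s)f''(s)}$$ exists, let $p_f$ be its Hölder conjugate, $\frac1{p_f}+\frac1{q_f}=1$, and assume $$p_{\mathrm c}:=\frac{N}{N-2}<p_f<p_{\mathrm S}:=\frac{N+2}{N-2}.$$ Put $F(s):=\int_s^\infty \frac{d\eta}{f(\eta)}$. This is a convergent integral for each $s>0$ and $F$ is one-to-one on $(0,\infty)$; let $F^{-1}$ be the inverse function, and $\tilde u(r):=F^{-1}\!\left(\frac{r^2}{2N-4q_f}\right)$. Put $$a:=\frac{4}{p_f-1}-N+2,\quad b:=2N-4q_f,\quad p_*:=1+\frac{4}{N-4+2\sqrt{N-1}},\quad \lambda_1:=\frac{a-\sqrt{a^2-4b}}{2},\quad \lambda_*:=\frac{2}{p_*-1}-\frac{N-2}{2},$$ and, for $0<r\le s$, $$P(r,s):=\begin{cases}(r/s)^{\lambda_1}& \text{if } p_{\mathrm c}<p_f<p_*,\\ \left(1+\log\frac sr\right)(r/s)^{\lambda_*}&\text{if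 } p_f=p_*,\\ (r/s)^{a/2}&\text{if } p_*<p_f<p_{\mathrm S}.\end{cases}$$ By a singular solution of $-\Delta u=f(u)$ in $B_{r_0}\setminus\{0\}\subset\mathbb R^N$ we mean a positive function $u\in C^2(B_{r_0}\setminus\{0\})$ satisfying the equation in $B_{r_0}\setminus\{0\}$ with $u(x)\to\infty$ as $x\to0$. Then there exist $r_0,\epsilon>0$ such that $\tilde u$ is well defined on $(0,r_0]$, and for all $\alpha,\beta>0$ with $\alpha+\beta<\epsilon$ there is a function $\theta\in C^2((0,r_0))\cap C^1((0,r_0])$ with $\theta(r)\to0$ as $r\to0$, $\theta(r_0)=\alpha$ and $r_0\theta'(r_0)=-\beta$ such that $$u(x)=\tilde u(|x|)\bigl(1+\theta(|x|)\bigr)=F^{-1}\!\left(\frac{|x|^2}{2N-4q_f}\right)\bigl(1+\theta(|x|)\bigr)$$ is a (radially symmetric) singular solution of $-\Delta u=f(u)$ in $B_{r_0}\setminus\{0\}$, and, as $x\to0$, $$|\theta(|x|)|+|x||\theta'(|x|)|=O\!\left(P(|x|,r_0)+\int_{|x|}^{r_0}P(|x|,s)\,\bigl|f'(\tilde u(s))F(\tilde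 u(s))-q_f\bigr|\,\frac{ds}{s}\right).$$ If moreover $f'(\tilde u(s))F(\tilde u(s))\ne q_f$ for some $s\in(0,r_0)$, then the term $P(|x|,r_0)$ can be omitted: $$|\theta(|x|)|+|x||\theta'(|x|)|=O\!\left(\int_{|x|}^{r_0}P(|x|,s)\,\bigl|f'(\tilde u(s))F(\tilde u(s))-q_f\bigr|\,\frac{ds}{s}\right)\quad\text{as }x\to0.$$ In particular, there are infinitely many radially symmetric singular solutions in $B_{r_0}\setminus\{0\}$ (pairwise different as functions on $B_{r_0}\setminus\{0\}$). -/

import Mathlib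

open Set Filter Topology Asymptotics

namespace SingularSolutions

noncomputable section

/-- The function `F(s) = ∫_s^∞ dη / f(η)`. -/
def F (f : ℝ → ℝ) (s : ℝ) : ℝ := ∫ t in Ioi s, 1 / f t

/-- The inverse `F⁻¹` of `F : (0,∞) → ℝ`; it is a genuine inverse on the range `F((0,∞))`. -/
def FInv (f : ℝ → ℝ) (y : ℝ) : ℝ := Function.invFunOn (F f) (Ioi 0) y

/-- The approximate singular solution `ũ(r) = F⁻¹(r² / (2N - 4q))`, as a function of `r = |x|`. -/
def uTilde (N : ℕ) (f : ℝ → ℝ) (q r : ℝ) : ℝ := FInv f (r ^ 2 / (2 * (N : ℝ) - 4 * q))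

/-- The critical exponent `p_c = N / (N - 2)`. -/
def pCrit (N : ℕ) : ℝ := (N : ℝ) / ((N : ℝ) - 2)

/-- The Sobolev exponent `p_S = (N + 2) / (N - 2)`. -/
def pSob (N : ℕ) : ℝ := ((N : ℝ) + 2) / ((N : ℝ) - 2)

/-- The exponent `p_* = 1 + 4 / (N - 4 + 2 √(N - 1))`. -/
def pStar (N : ℕ) : ℝ := 1 + 4 / ((N : ℝ) - 4 + 2 * √((N : ℝ) - 1))

/-- The coefficient `a = 4 / (p - 1) - N + 2`. -/
def coeffA (N : ℕ) (p : ℝ) : ℝ := 4 / (p - 1) - (N : ℝ) + 2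

/-- The coefficient `b = 2N - 4q`. -/
def coeffB (N : ℕ) (q : ℝ) : ℝ := 2 * (N : ℝ) - 4 * q

/-- For `p_c < p < p_*` the equation `λ² + a λ + b = 0` has two real roots `-λ₂ < -λ₁ < 0`;
this is `λ₁`, the smaller of the two absolute values. -/
def lambdaOne (N : ℕ) (p q : ℝ) : ℝ :=
  (coeffA N p - √(coeffA N p ^ 2 - 4 * coeffB N q)) / 2

/-- For `p = p_*` the equation `λ² + a λ + b = 0` has the unique root `-λ_*`. -/
def lambdaStar (N : ℕ) : ℝ := 2 / (pStar N - 1) - ((N : ℝ) - 2) / 2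

/-- The weight `P(r, s)`, for `0 < r ≤ s`. -/
def P (N : ℕ) (p q r s : ℝ) : ℝ :=
  if p < pStar N then (r / s) ^ lambdaOne N p q
  else if p = pStar N then (1 + Real.log (s / r)) * (r / s) ^ lambdaStar N
  else (r / s) ^ (coeffA N p / 2)

/-- The weighted integral
`∫_r^{r₀} P(r, s) |f'(ũ(s)) F(ũ(s)) - q| ds / s`. -/
def errorIntegral (N : ℕ) (f : ℝ → ℝ) (p q r₀ r : ℝ) : ℝ :=
  ∫ s in r..r₀, P N p q r s *
    |deriv f (uTilde N f q s) * F f (uTilde N f q s) - q| * (1 / s)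

/-- The punctured ball `B_{r₀} \ {0}` in `ℝ^N`. -/
def puncturedBall (N : ℕ) (r₀ : ℝ) : Set (EuclideanSpace ℝ (Fin N)) :=
  Metric.ball 0 r₀ \ {0}

/-- `u` is a (positive) singular solution of `-Δ u = f(u)` in `B_{r₀} \ {0}`. -/
structure IsSingularSolution (N : ℕ) (f : ℝ → ℝ) (r₀ : ℝ)
    (u : EuclideanSpace ℝ (Fin N) → ℝ) : Prop where
  contDiffOn : ContDiffOn ℝ 2 u (puncturedBall N r₀)
  pos : ∀ x ∈ puncturedBall N r₀, 0 < u x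
  equation : ∀ x ∈ puncturedBall N r₀, -(Laplacian.laplacian u x) = f (u x)
  singular : Tendsto u (𝓝[≠] 0) atTop

/-- `u` is radially symmetric in `B_{r₀} \ {0}`. -/
def IsRadial (N : ℕ) (r₀ : ℝ) (u : EuclideanSpace ℝ (Fin N) → ℝ) : Prop :=
  ∀ x ∈ puncturedBall N r₀, ∀ y ∈ puncturedBall N r₀, ‖x‖ = ‖y‖ → u x = u y

end

end SingularSolutions

/-! Put τ = -log r and write the unknown as u = U(τ)(1 + θ(τ)), where F(U) = e^{-2τ}/b and b = 2N -
4q. Then U' = 2F(U)f(U), and the radial equation u'' - (N-2)u' + e^{-2τ}f(u) = 0 becomes θ'' + aθ' +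
bθ = n(τ, θ, θ'). The right-hand side n is made of a Taylor remainder of f, which has a small
Lipschitz constant in θ, and of two deviations along the profile, E = f'(U)F(U) - q and G =
F(U)f(U)/U - (q-1). Both deviations tend to 0 by l'Hôpital-type arguments (`tendsto_deriv_mul_F`,
`tendsto_F_mul_div`). The condition p_c < p < p_S gives a > 0 and b > 0, so both characteristic
roots have negative real part.

Existence is a contraction argument on the forcing n in bounded continuous functions
(`exists_small_solution`): for large τ₀ the deviations are small, and θ(τ₀) = α, θ'(τ₀) = β can be
prescribed freely as long as they are small.

The rate requires more, since a plain Grönwall argument loses part of the exponent. The operator is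
factored into (d/dτ + ν)(d/dτ + μ), and a Lyapunov-type functional absorbs what is not E
(`exists_decay_factor`). Quadratic terms decay at more than the linear rate. The deviation G solves
G' = 2g(E - G) with g → q-1, so it relaxes at a rate near 2(q-1), and 2(q-1) > a/2; hence G is
subordinate to E. What remains is the homogeneous kernel plus its convolution with |E|, and this
kernel is P written in logarithmic variables (`P_exp_eq_decayKernel`). If E does not vanish
identically, the convolution alone dominates the homogeneous term
(`exists_decayKernel_le_integral`). Distinct boundary values α give distinct solutions, hence
infinitely many. -/

namespace SingularSolutions

/-! ### Growth of f and asymptotics of F -/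

/-- A positive increasing `C²` nonlinearity whose growth exponent is `p > 1`, with Hölder
conjugate `q`. -/
structure IsSuperlinear (f : ℝ → ℝ) (p q : ℝ) : Prop where
  contDiffOn : ContDiffOn ℝ 2 f (Ioi 0)
  pos : ∀ s, 0 < s → 0 < f s
  deriv_pos : ∀ s, 0 < s → 0 < deriv f s
  tendsto : Tendsto (fun s => deriv f s ^ 2 / (f s * deriv (deriv f) s)) atTop (𝓝 q)
  conj : 1 / p + 1 / q = 1
  one_lt : 1 < p

/-- A function whose derivative converges to `L` at infinity grows like `L s`. -/
theorem tendsto_div_of_tendsto_deriv {h h' : ℝ → ℝ} {L s₀ : ℝ}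
    (hd : ∀ s, s₀ < s → HasDerivAt h (h' s) s) (hl : Tendsto h' atTop (𝓝 L)) :
    Tendsto (fun s => h s / s) atTop (𝓝 L) := by
  rw [Metric.tendsto_atTop]
  intro ε hε
  obtain ⟨s₁, hs₁⟩ := (Metric.tendsto_atTop.1 hl) (ε / 2) (by positivity)
  set s₂ := max (max s₁ (s₀ + 1)) 1 with hs₂
  have h1 : s₁ ≤ s₂ := le_trans (le_max_left _ _) (le_max_left _ _)
  have h2 : s₀ < s₂ := by
    have : s₀ + 1 ≤ s₂ := le_trans (le_max_right _ _) (le_max_left _ _)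
    linarith
  have h3 : 1 ≤ s₂ := le_max_right _ _
  set K := |h s₂ - L * s₂| with hK
  refine ⟨max s₂ (4 * K / ε + 1), fun s hs => ?_⟩
  have hs2 : s₂ ≤ s := le_trans (le_max_left _ _) hs
  have hsK : 4 * K / ε + 1 ≤ s := le_trans (le_max_right _ _) hs
  have key : ‖(h s - L * s) - (h s₂ - L * s₂)‖ ≤ ε / 2 * (s - s₂) := by
    refine norm_image_sub_le_of_norm_deriv_le_segment' (f := fun x => h x - L * x)
      (f' := fun x => h' x - L) (a := s₂) (b := s) ?_ ?_ s ⟨hs2, le_rfl⟩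
    · intro x hx
      have := (hd x (lt_of_lt_of_le h2 hx.1)).fun_sub ((hasDerivAt_id' x).const_mul L)
      rw [mul_one] at this
      exact this.hasDerivWithinAt
    · intro x hx
      have := hs₁ x (h1.trans hx.1)
      rw [Real.dist_eq] at this
      exact this.le
  have hspos : 0 < s := by linarith
  rw [Real.dist_eq, show h s / s - L = (h s - L * s) / s by field_simp, abs_div, abs_of_pos hspos,
    div_lt_iff₀ hspos]
  rw [Real.norm_eq_abs] at key
  have h4 : |h s - L * s| ≤ |(h s - L * s) - (h s₂ - L * s₂)| + K := by
    have := abs_add_le ((h s - L * s) - (h s₂ - L * s₂)) (h s₂ - L * s₂)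
    simpa using this
  have h5 : K < ε / 4 * s := by
    have : 4 * K / ε < s := by linarith
    rw [div_lt_iff₀ hε] at this
    linarith
  nlinarith

namespace IsSuperlinear

variable {f : ℝ → ℝ} {p q : ℝ}

theorem p_pos (h : IsSuperlinear f p q) : 0 < p := by linarith [h.one_lt]

theorem one_lt_q (h : IsSuperlinear f p q) : 1 < q := by
  have h1 := h.one_lt
  have hp := h.p_pos
  have hq : 1 / q = 1 - 1 / p := by linarith [h.conj]
  have h2 : 1 / p < 1 := by rw [div_lt_one hp]; exact h1
  have h3 : 0 < 1 / q := by linarith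
  have h4 : 0 < q := by simpa using h3
  have h5 : 1 / q < 1 := by have : 0 < 1 / p := by positivity
                            linarith
  rwa [div_lt_one h4] at h5

theorem conj_mul (h : IsSuperlinear f p q) : p + q = p * q := by
  have hp := h.p_pos
  have hq : 0 < q := by linarith [h.one_lt_q]
  have := h.conj
  field_simp at this
  linarith

theorem hasDerivAt (h : IsSuperlinear f p q) {s : ℝ} (hs : 0 < s) :
    HasDerivAt f (deriv f s) s :=
  ((h.contDiffOn.differentiableOn (by norm_num)).differentiableAt (Ioi_mem_nhds hs)).hasDerivAt

theorem contDiffOn_deriv (h : IsSuperlinear f p q) : ContDiffOn ℝ 1 (deriv f) (Ioi 0) :=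
  h.contDiffOn.deriv_of_isOpen isOpen_Ioi (by norm_num)

theorem hasDerivAt_deriv (h : IsSuperlinear f p q) {s : ℝ} (hs : 0 < s) :
    HasDerivAt (deriv f) (deriv (deriv f) s) s :=
  ((h.contDiffOn_deriv.differentiableOn (by norm_num)).differentiableAt
    (Ioi_mem_nhds hs)).hasDerivAt

theorem continuousOn (h : IsSuperlinear f p q) : ContinuousOn f (Ioi 0) := h.contDiffOn.continuousOn

theorem continuousOn_deriv (h : IsSuperlinear f p q) : ContinuousOn (deriv f) (Ioi 0) :=
  h.contDiffOn_deriv.continuousOn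

theorem tendsto_inv (h : IsSuperlinear f p q) :
    Tendsto (fun s => f s * deriv (deriv f) s / deriv f s ^ 2) atTop (𝓝 (1 / q)) := by
  have := h.tendsto.inv₀ (by linarith [h.one_lt_q])
  simpa using this

/-- `f'(s) s / f(s) → p`. -/
theorem tendsto_logDeriv (h : IsSuperlinear f p q) :
    Tendsto (fun s => s * deriv f s / f s) atTop (𝓝 p) := by
  -- The function f/f' has derivative 1 - f f''/f'², which tends to 1 - 1/q = 1/p, so f/f' grows
  -- like s/p.
  have h1 : Tendsto (fun s => f s / deriv f s / s) atTop (𝓝 (1 / p)) := by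
    refine tendsto_div_of_tendsto_deriv (s₀ := 0)
      (h' := fun s => 1 - f s * deriv (deriv f) s / deriv f s ^ 2) ?_ ?_
    · intro s hs
      have h0 := (h.deriv_pos s hs).ne'
      refine ((h.hasDerivAt hs).fun_div (h.hasDerivAt_deriv hs) h0).congr_deriv ?_
      rw [sub_div, ← sq, div_self (pow_ne_zero 2 h0)]
    · have := h.tendsto_inv.const_sub 1
      rwa [show 1 - 1 / q = 1 / p by linarith [h.conj]] at this
  have := h1.inv₀ (by have := h.p_pos; positivity)
  refine (this.congr' ?_).trans (by simp)
  filter_upwards [eventually_gt_atTop 0] with s hs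
  rw [div_div, inv_div, mul_comm]

theorem tendsto_sq_mul_deriv_deriv (h : IsSuperlinear f p q) :
    Tendsto (fun s => s ^ 2 * deriv (deriv f) s / f s) atTop (𝓝 (p ^ 2 * (1 / q))) := by
  refine ((h.tendsto_logDeriv.pow 2).mul h.tendsto_inv).congr' ?_
  filter_upwards [eventually_gt_atTop 0] with s hs
  have := (h.deriv_pos s hs).ne'
  have := (h.pos s hs).ne'
  field_simp

/-- Polynomial lower bound with an exponent larger than one. -/
theorem exists_rpow_le (h : IsSuperlinear f p q) :
    ∃ s₁ > 0, ∃ c > 0, ∀ s ≥ s₁, c * s ^ ((1 + p) / 2) ≤ f s := by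
  have hp := h.one_lt
  -- The exponent (1+p)/2 lies strictly between 1 and p: below p, so that f(s)s^{-(1+p)/2}
  -- eventually increases; above 1, so that 1/f is integrable at infinity.
  have hm : (1 + p) / 2 < p := by linarith
  obtain ⟨s₁, hs₁⟩ := eventually_atTop.1
    ((h.tendsto_logDeriv.eventually (lt_mem_nhds hm)).and (eventually_gt_atTop 0))
  have hs0 : 0 < s₁ := (hs₁ s₁ le_rfl).2
  refine ⟨s₁, hs0, f s₁ * s₁ ^ (-((1 + p) / 2)), by have := h.pos s₁ hs0; positivity, ?_⟩
  have mono : MonotoneOn (fun s => f s * s ^ (-((1 + p) / 2))) (Ici s₁) := by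
    have hd : ∀ s ∈ Ici s₁, HasDerivAt (fun s => f s * s ^ (-((1 + p) / 2)))
        (deriv f s * s ^ (-((1 + p) / 2)) +
          f s * ((-((1 + p) / 2)) * s ^ (-((1 + p) / 2) - 1))) s := by
      intro s hs
      have hspos : 0 < s := lt_of_lt_of_le hs0 hs
      exact (h.hasDerivAt hspos).mul (Real.hasDerivAt_rpow_const (Or.inl hspos.ne'))
    refine monotoneOn_of_deriv_nonneg (convex_Ici _)
      (fun s hs => (hd s hs).continuousAt.continuousWithinAt) ?_ ?_
    · intro s hs
      rw [interior_Ici] at hs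
      exact (hd s (mem_Ici.2 (le_of_lt hs))).differentiableAt.differentiableWithinAt
    · intro s hs
      rw [interior_Ici] at hs
      have hspos : 0 < s := lt_trans hs0 hs
      rw [(hd s (mem_Ici.2 (le_of_lt hs))).deriv, Real.rpow_sub_one hspos.ne']
      have h1 := (hs₁ s (le_of_lt hs)).1
      rw [lt_div_iff₀ (h.pos s hspos)] at h1
      have h2 : 0 < s ^ (-((1 + p) / 2)) := by positivity
      have : deriv f s * s ^ (-((1 + p) / 2)) +
          f s * ((-((1 + p) / 2)) * (s ^ (-((1 + p) / 2)) / s)) =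
          (s * deriv f s - (1 + p) / 2 * f s) * (s ^ (-((1 + p) / 2)) / s) := by
        field_simp
        ring
      rw [this]
      exact mul_nonneg (by linarith) (by positivity)
  intro s hs
  have hspos : 0 < s := lt_of_lt_of_le hs0 hs
  have h1 := mono (mem_Ici.2 le_rfl) (mem_Ici.2 hs) hs
  simp only at h1
  calc f s₁ * s₁ ^ (-((1 + p) / 2)) * s ^ ((1 + p) / 2)
      ≤ f s * s ^ (-((1 + p) / 2)) * s ^ ((1 + p) / 2) := by gcongr
    _ = f s := by
      rw [mul_assoc, ← Real.rpow_add hspos]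
      simp

theorem integrableOn (h : IsSuperlinear f p q) {s : ℝ} (hs : 0 < s) :
    MeasureTheory.IntegrableOn (fun t => 1 / f t) (Ioi s) := by
  obtain ⟨s₁, hs₁, c, hc, hb⟩ := h.exists_rpow_le
  have hcont : ContinuousOn (fun t => 1 / f t) (Ioi 0) :=
    continuousOn_const.div h.continuousOn fun t ht => (h.pos t ht).ne'
  set S := max s s₁
  have hS : 0 < S := lt_max_of_lt_left hs
  have h1 : MeasureTheory.IntegrableOn (fun t => 1 / f t) (Icc s S) :=
    (hcont.mono fun t ht => lt_of_lt_of_le hs ht.1).integrableOn_Icc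
  have h2 : MeasureTheory.IntegrableOn (fun t => 1 / f t) (Ioi S) := by
    have hp := h.one_lt
    have h3 := (integrableOn_Ioi_rpow_of_lt (show -((1 + p) / 2) < -1 by linarith) hS).const_mul
      (1 / c)
    refine MeasureTheory.Integrable.mono' h3
      ((hcont.mono fun t ht => hS.trans ht).aestronglyMeasurable measurableSet_Ioi) ?_
    refine (MeasureTheory.ae_restrict_iff' measurableSet_Ioi).2 (Eventually.of_forall fun t ht => ?_)
    have ht0 : 0 < t := hS.trans ht
    have h4 := hb t ((le_max_right s s₁).trans (le_of_lt ht))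
    have h5 : 0 < c * t ^ ((1 + p) / 2) := by positivity
    rw [Real.norm_eq_abs, abs_of_pos (by have := h.pos t ht0; positivity), Real.rpow_neg ht0.le]
    calc 1 / f t ≤ 1 / (c * t ^ ((1 + p) / 2)) := one_div_le_one_div_of_le h5 h4
      _ = _ := by field_simp
  have := h1.union h2
  refine this.mono_set fun t ht => ?_
  rcases le_or_gt t S with h' | h'
  · exact Or.inl ⟨le_of_lt ht, h'⟩
  · exact Or.inr h'

theorem hasDerivAt_F (h : IsSuperlinear f p q) {s : ℝ} (hs : 0 < s) :
    HasDerivAt (F f) (-(1 / f s)) s := by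
  have hcont : ContinuousOn (fun t => 1 / f t) (Ioi 0) :=
    continuousOn_const.div h.continuousOn fun t ht => (h.pos t ht).ne'
  have hi : ∀ t, 0 < t → IntervalIntegrable (fun t => 1 / f t) MeasureTheory.volume (s / 2) t := by
    intro t ht
    refine (hcont.mono ?_).intervalIntegrable
    intro x hx
    have := hx.1
    exact lt_of_lt_of_le (lt_min (by positivity) ht) this
  have h1 : HasDerivAt (fun u => ∫ t in (s / 2)..u, 1 / f t) (1 / f s) s :=
    intervalIntegral.integral_hasDerivAt_right (hi s hs)
      (hcont.stronglyMeasurableAtFilter isOpen_Ioi s hs) (hcont.continuousAt (Ioi_mem_nhds hs))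
  refine (h1.const_sub (F f (s / 2))).congr_of_eventuallyEq ?_
  filter_upwards [Ioi_mem_nhds hs] with u hu
  have := intervalIntegral.integral_interval_add_Ioi' (μ := MeasureTheory.volume) (hi u hu)
    (h.integrableOn hu)
  simp only [F]
  linarith

theorem F_pos (h : IsSuperlinear f p q) {s : ℝ} (hs : 0 < s) : 0 < F f s := by
  have hi := h.integrableOn hs
  rw [F, MeasureTheory.setIntegral_pos_iff_support_of_nonneg_ae ?_ hi]
  · have : Function.support (fun t => 1 / f t) ∩ Ioi s = Ioi s := by
      refine inter_eq_right.2 fun t ht => ?_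
      have := h.pos t (hs.trans ht)
      simp [this.ne']
    rw [this]
    simp
  · refine (MeasureTheory.ae_restrict_iff' measurableSet_Ioi).2 (Eventually.of_forall fun t ht => ?_)
    have := h.pos t (hs.trans ht)
    simp only [Pi.zero_apply]
    positivity

theorem strictAntiOn_F (h : IsSuperlinear f p q) : StrictAntiOn (F f) (Ioi 0) := by
  refine strictAntiOn_of_deriv_neg (convex_Ioi _)
    (fun s hs => (h.hasDerivAt_F hs).continuousAt.continuousWithinAt) ?_
  intro s hs
  rw [interior_Ioi] at hs
  rw [(h.hasDerivAt_F hs).deriv]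
  have := h.pos s hs
  simp only [neg_lt_zero]
  positivity

theorem tendsto_F (h : IsSuperlinear f p q) : Tendsto (F f) atTop (𝓝 0) := by
  have hi := h.integrableOn one_pos
  have h1 := MeasureTheory.intervalIntegral_tendsto_integral_Ioi 1 hi tendsto_id
  have h2 := h1.const_sub (F f 1)
  have h3 : F f 1 - ∫ t in Ioi (1 : ℝ), 1 / f t = 0 := sub_self _
  rw [h3] at h2
  refine h2.congr' ?_
  filter_upwards [eventually_ge_atTop 1] with s hs
  have := intervalIntegral.integral_interval_add_Ioi (μ := MeasureTheory.volume) hi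
    (h.integrableOn (lt_of_lt_of_le one_pos hs))
  simp only [F, id]
  linarith

theorem tendsto_deriv_atTop (h : IsSuperlinear f p q) : Tendsto (deriv f) atTop atTop := by
  obtain ⟨s₁, hs₁, c, hc, hb⟩ := h.exists_rpow_le
  have hp := h.one_lt
  have h1 : Tendsto (fun s : ℝ => c * s ^ ((p - 1) / 2)) atTop atTop :=
    (tendsto_rpow_atTop (by linarith)).const_mul_atTop hc
  refine tendsto_atTop_mono' _ ?_ h1
  filter_upwards [h.tendsto_logDeriv.eventually (lt_mem_nhds hp), eventually_ge_atTop s₁]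
    with s h2 h3
  have hs : 0 < s := lt_of_lt_of_le hs₁ h3
  rw [lt_div_iff₀ (h.pos s hs), one_mul] at h2
  have h4 := hb s h3
  rw [show (1 + p) / 2 = (p - 1) / 2 + 1 by ring, Real.rpow_add_one hs.ne'] at h4
  have h5 : s * (c * s ^ ((p - 1) / 2)) ≤ s * deriv f s := by linarith
  exact le_of_mul_le_mul_left h5 hs

/-- `f'(s) F(s) → q`. -/
theorem tendsto_deriv_mul_F (h : IsSuperlinear f p q) :
    Tendsto (fun s => deriv f s * F f s) atTop (𝓝 q) := by
  have h1 : Tendsto (fun s => F f s / (deriv f s)⁻¹) atTop (𝓝 q) := by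
    -- For F/(1/f') the quotient of derivatives is exactly f'²/(f f'').
    refine HasDerivAt.lhopital_zero_atTop (f' := fun s => -(1 / f s))
      (g' := fun s => -deriv (deriv f) s / deriv f s ^ 2) ?_ ?_ ?_ h.tendsto_F
      h.tendsto_deriv_atTop.inv_tendsto_atTop ?_
    · filter_upwards [eventually_gt_atTop 0] with s hs using h.hasDerivAt_F hs
    · filter_upwards [eventually_gt_atTop 0] with s hs using
        (h.hasDerivAt_deriv hs).inv (h.deriv_pos s hs).ne'
    · have hq : 0 < 1 / q := by have := h.one_lt_q; positivity
      filter_upwards [eventually_gt_atTop 0, h.tendsto_inv.eventually (lt_mem_nhds hq)] with s hs h2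
      intro h3
      have h4 := (h.deriv_pos s hs).ne'
      have : deriv (deriv f) s = 0 := by simpa [h4] using h3
      simp [this] at h2
    · refine h.tendsto.congr' ?_
      filter_upwards [eventually_gt_atTop 0] with s hs
      have h2 := (h.pos s hs).ne'
      have h4 := (h.deriv_pos s hs).ne'
      rw [neg_div (_ ^ 2), neg_div_neg_eq]
      field_simp
  refine h1.congr fun s => ?_
  rw [div_inv_eq_mul, mul_comm]

/-- `F(s) f(s) / s → q - 1`. -/
theorem tendsto_F_mul_div (h : IsSuperlinear f p q) :
    Tendsto (fun s => F f s * f s / s) atTop (𝓝 (q - 1)) := by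
  -- F f/s is the quotient of f'F → q by s f'/f → p, and q/p = q - 1 because p + q = pq.
  have h1 := h.tendsto_deriv_mul_F.div h.tendsto_logDeriv h.p_pos.ne'
  have h2 : q / p = q - 1 := by
    rw [div_eq_iff h.p_pos.ne']
    linarith [h.conj_mul]
  rw [h2] at h1
  refine h1.congr' ?_
  filter_upwards [eventually_gt_atTop 0] with s hs
  have h2 := (h.pos s hs).ne'
  have h4 := (h.deriv_pos s hs).ne'
  simp only [Pi.div_apply]
  field_simp

theorem FInv_F (h : IsSuperlinear f p q) {s : ℝ} (hs : 0 < s) : FInv f (F f s) = s :=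
  h.strictAntiOn_F.injOn.leftInvOn_invFunOn hs

theorem contDiffOn_F (h : IsSuperlinear f p q) : ContDiffOn ℝ 1 (F f) (Ioi 0) := by
  rw [show (1 : WithTop ℕ∞) = 0 + 1 by rfl, contDiffOn_succ_iff_deriv_of_isOpen isOpen_Ioi]
  refine ⟨fun t ht => (h.hasDerivAt_F ht).differentiableAt.differentiableWithinAt, by simp, ?_⟩
  rw [contDiffOn_zero]
  refine ContinuousOn.congr (f := fun t => -(1 / f t)) ?_ fun t ht => (h.hasDerivAt_F ht).deriv
  exact (continuousOn_const.div h.continuousOn fun t ht => (h.pos t ht).ne').neg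

/-- `FInv` is defined by choice, so its smoothness is borrowed from the local inverse of the inverse
function theorem. Near F(s) that local inverse stays positive, and injectivity of F on (0,∞) makes
the two agree. -/
theorem hasDerivAt_FInv (h : IsSuperlinear f p q) {s : ℝ} (hs : 0 < s) :
    HasDerivAt (FInv f) (-(f s)) (F f s) := by
  have hne : -(1 / f s) ≠ 0 := by have := h.pos s hs; simp [this.ne']
  have hc : ContDiffAt ℝ 1 (F f) s := h.contDiffOn_F.contDiffAt (Ioi_mem_nhds hs)
  have hst : HasStrictDerivAt (F f) (-(1 / f s)) s :=
    hc.hasStrictDerivAt' (h.hasDerivAt_F hs) (by norm_num)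
  have hfd := hst.hasStrictFDerivAt_equiv hne
  have h1 := (hst.to_localInverse hne).hasDerivAt
  have h2 : ∀ᶠ y in 𝓝 (F f s), F f (hst.localInverse _ _ _ hne y) = y :=
    hfd.eventually_right_inverse
  have h3 : hst.localInverse _ _ _ hne (F f s) = s := hfd.localInverse_apply_image
  have h4 : ∀ᶠ y in 𝓝 (F f s), 0 < hst.localInverse _ _ _ hne y := by
    have := h1.continuousAt
    rw [ContinuousAt, h3] at this
    exact this.eventually (lt_mem_nhds hs)
  have h5 : FInv f =ᶠ[𝓝 (F f s)] hst.localInverse _ _ _ hne := by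
    filter_upwards [h2, h4] with y hy hy'
    nth_rewrite 1 [← hy]
    exact h.FInv_F hy'
  have := h1.congr_of_eventuallyEq h5
  rwa [inv_neg, one_div, inv_inv] at this

/-- `F` attains every value in `(0, F(s)]`. -/
theorem mem_image_F (h : IsSuperlinear f p q) {s y : ℝ} (hs : 0 < s) (hy : 0 < y)
    (hys : y ≤ F f s) : y ∈ F f '' Ioi 0 := by
  obtain ⟨s₁, hs₁⟩ := eventually_atTop.1
    ((h.tendsto_F.eventually (gt_mem_nhds hy)).and (eventually_ge_atTop s))
  obtain ⟨h1, h2⟩ := hs₁ s₁ le_rfl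
  have hc : ContinuousOn (F f) (Icc s s₁) := fun t ht =>
    (h.hasDerivAt_F (lt_of_lt_of_le hs ht.1)).continuousAt.continuousWithinAt
  obtain ⟨t, ht, rfl⟩ := intermediate_value_Icc' h2 hc ⟨h1.le, hys⟩
  exact ⟨t, lt_of_lt_of_le hs ht.1, rfl⟩

end IsSuperlinear

/-! ### First-order linear equations, majorants and Grönwall inequalities -/

/-- The solution of `x' = -c x + n`, `x(τ₀) = x₀`. -/
noncomputable def duhamel (c : ℂ) (τ₀ : ℝ) (x₀ : ℂ) (n : ℝ → ℂ) (τ : ℝ) : ℂ :=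
  Complex.exp (-c * ((τ - τ₀ : ℝ) : ℂ)) *
    (x₀ + ∫ s in τ₀..τ, Complex.exp (c * ((s - τ₀ : ℝ) : ℂ)) * n s)

theorem hasDerivAt_cexp_mul_sub (c : ℂ) (τ₀ τ : ℝ) :
    HasDerivAt (fun t : ℝ => Complex.exp (c * ((t - τ₀ : ℝ) : ℂ)))
      (c * Complex.exp (c * ((τ - τ₀ : ℝ) : ℂ))) τ := by
  have h1 : HasDerivAt (fun t : ℝ => ((t - τ₀ : ℝ) : ℂ)) 1 τ := by
    simpa using ((hasDerivAt_id' τ).sub_const τ₀).ofReal_comp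
  have := (h1.const_mul c).cexp
  rw [mul_one] at this
  rwa [mul_comm c (Complex.exp _)]

theorem duhamel_self (c : ℂ) (τ₀ : ℝ) (x₀ : ℂ) (n : ℝ → ℂ) : duhamel c τ₀ x₀ n τ₀ = x₀ := by
  simp [duhamel]

theorem hasDerivAt_duhamel (c : ℂ) (τ₀ : ℝ) (x₀ : ℂ) {n : ℝ → ℂ} (hn : Continuous n) (τ : ℝ) :
    HasDerivAt (duhamel c τ₀ x₀ n) (-c * duhamel c τ₀ x₀ n τ + n τ) τ := by
  have hc : Continuous fun s : ℝ => Complex.exp (c * ((s - τ₀ : ℝ) : ℂ)) * n s := by fun_prop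
  have h1 := (hc.integral_hasStrictDerivAt τ₀ τ).hasDerivAt.const_add x₀
  have h2 := (hasDerivAt_cexp_mul_sub (-c) τ₀ τ).mul h1
  refine h2.congr_deriv ?_
  rw [duhamel, ← mul_assoc (Complex.exp (-c * _)) (Complex.exp _), ← Complex.exp_add]
  simp
  ring

/-- A solution of a scalar linear equation is dominated by the solution of the equation with
absolute values. -/
theorem exists_majorant {c : ℂ} {τ₀ : ℝ} {x n : ℝ → ℂ}
    (hx : ∀ τ ≥ τ₀, HasDerivAt x (-c * x τ + n τ) τ) (hn : ContinuousOn n (Ici τ₀)) :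
    ∃ M : ℝ → ℝ, M τ₀ = ‖x τ₀‖ ∧
      ∀ τ ≥ τ₀, HasDerivAt M (-c.re * M τ + ‖n τ‖) τ ∧ ‖x τ‖ ≤ M τ := by
  -- Freezing n to the left of τ₀ gives a function continuous on the whole line, so its primitive is
  -- differentiable at τ₀ too.
  set n₁ : ℝ → ℝ := fun τ => ‖n (max τ τ₀)‖ with hn₁
  have hc₁ : Continuous n₁ := by
    refine (hn.comp_continuous (by fun_prop) fun τ => ?_).norm
    exact mem_Ici.2 (le_max_right _ _)
  have he : ∀ τ ≥ τ₀, n₁ τ = ‖n τ‖ := fun τ hτ => by simp only [hn₁, max_eq_left hτ]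
  set I : ℝ → ℝ := fun τ => ‖x τ₀‖ + ∫ s in τ₀..τ, Real.exp (c.re * (s - τ₀)) * n₁ s with hI
  have hcI : Continuous fun s : ℝ => Real.exp (c.re * (s - τ₀)) * n₁ s := by fun_prop
  have hdI : ∀ τ, HasDerivAt I (Real.exp (c.re * (τ - τ₀)) * n₁ τ) τ := fun τ =>
    (hcI.integral_hasStrictDerivAt τ₀ τ).hasDerivAt.const_add _
  have hdE : ∀ τ, HasDerivAt (fun t : ℝ => Real.exp (-c.re * (t - τ₀)))
      (-c.re * Real.exp (-c.re * (τ - τ₀))) τ := fun τ => by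
    have := ((((hasDerivAt_id' τ).sub_const τ₀).const_mul (-c.re))).exp
    refine this.congr_deriv ?_
    ring
  refine ⟨fun τ => Real.exp (-c.re * (τ - τ₀)) * I τ, by simp [hI], fun τ hτ => ⟨?_, ?_⟩⟩
  · refine ((hdE τ).mul (hdI τ)).congr_deriv ?_
    rw [← he τ hτ, ← mul_assoc (Real.exp (-c.re * _)) (Real.exp _), ← Real.exp_add]
    simp
    ring
  · have key : ‖Complex.exp (c * ((τ - τ₀ : ℝ) : ℂ)) * x τ‖ ≤ I τ := by
      have hd : ∀ t ≥ τ₀, HasDerivAt (fun t : ℝ => Complex.exp (c * ((t - τ₀ : ℝ) : ℂ)) * x t)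
          (Complex.exp (c * ((t - τ₀ : ℝ) : ℂ)) * n t) t := fun t ht => by
        refine ((hasDerivAt_cexp_mul_sub c τ₀ t).mul (hx t ht)).congr_deriv ?_
        ring
      refine image_norm_le_of_norm_deriv_right_le_deriv_boundary
        (f := fun t : ℝ => Complex.exp (c * ((t - τ₀ : ℝ) : ℂ)) * x t)
        (f' := fun t : ℝ => Complex.exp (c * ((t - τ₀ : ℝ) : ℂ)) * n t)
        (B := I) (a := τ₀) (b := τ) (B' := fun t => Real.exp (c.re * (t - τ₀)) * n₁ t)
        (fun t ht => (hd t ht.1).continuousAt.continuousWithinAt)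
        (fun t ht => (hd t ht.1).hasDerivWithinAt) (by simp [hI]) hdI ?_ ⟨hτ, le_rfl⟩
      intro t ht
      rw [norm_mul, Complex.norm_exp, he t ht.1]
      simp
    rw [norm_mul, Complex.norm_exp, Complex.re_mul_ofReal] at key
    calc ‖x τ‖ = Real.exp (-c.re * (τ - τ₀)) * (Real.exp (c.re * (τ - τ₀)) * ‖x τ‖) := by
          rw [← mul_assoc, ← Real.exp_add]
          simp
      _ ≤ _ := mul_le_mul_of_nonneg_left key (Real.exp_pos _).le

/-- The real-valued version of `exists_majorant`. -/
theorem exists_majorant_real {c τ₀ : ℝ} {x n : ℝ → ℝ}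
    (hx : ∀ τ ≥ τ₀, HasDerivAt x (-c * x τ + n τ) τ) (hn : ContinuousOn n (Ici τ₀)) :
    ∃ M : ℝ → ℝ, M τ₀ = |x τ₀| ∧
      ∀ τ ≥ τ₀, HasDerivAt M (-c * M τ + |n τ|) τ ∧ |x τ| ≤ M τ := by
  obtain ⟨M, h0, hM⟩ := exists_majorant (c := c) (τ₀ := τ₀) (x := fun τ => (x τ : ℂ))
    (n := fun τ => (n τ : ℂ)) (fun τ hτ => by
      have := (hx τ hτ).ofReal_comp
      push_cast at this
      exact this) (Complex.continuous_ofReal.comp_continuousOn hn)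
  refine ⟨M, by simpa using h0, fun τ hτ => ?_⟩
  have := hM τ hτ
  simpa using this

theorem antitoneOn_of_hasDerivAt_nonpos {τ₀ : ℝ} {x x' : ℝ → ℝ}
    (hx : ∀ τ ≥ τ₀, HasDerivAt x (x' τ) τ) (hle : ∀ τ ≥ τ₀, x' τ ≤ 0) : AntitoneOn x (Ici τ₀) := by
  refine antitoneOn_of_deriv_nonpos (convex_Ici _)
    (fun s hs => (hx s hs).continuousAt.continuousWithinAt) ?_ ?_
  · intro s hs
    rw [interior_Ici] at hs
    exact (hx s (le_of_lt hs)).differentiableAt.differentiableWithinAt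
  · intro s hs
    rw [interior_Ici] at hs
    rw [(hx s (le_of_lt hs)).deriv]
    exact hle s (le_of_lt hs)

/-- Grönwall's inequality for `x' ≤ -c x + h`. -/
theorem le_of_deriv_le {c τ₀ : ℝ} {x x' h : ℝ → ℝ} (hx : ∀ τ ≥ τ₀, HasDerivAt x (x' τ) τ)
    (hle : ∀ τ ≥ τ₀, x' τ ≤ -c * x τ + h τ) (hh : ContinuousOn h (Ici τ₀)) {τ : ℝ} (hτ : τ₀ ≤ τ) :
    x τ ≤ Real.exp (-c * (τ - τ₀)) * x τ₀ + ∫ s in τ₀..τ, Real.exp (-c * (τ - s)) * h s := by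
  set h₁ : ℝ → ℝ := fun τ => h (max τ τ₀) with hh₁
  have hc₁ : Continuous h₁ := hh.comp_continuous (by fun_prop) fun τ => mem_Ici.2 (le_max_right _ _)
  have he : ∀ τ ≥ τ₀, h₁ τ = h τ := fun τ hτ => by simp only [hh₁, max_eq_left hτ]
  have hcI : Continuous fun s : ℝ => Real.exp (c * s) * h₁ s := by fun_prop
  have hd : ∀ τ ≥ τ₀, HasDerivAt
      (fun t => Real.exp (c * t) * x t - ∫ s in τ₀..t, Real.exp (c * s) * h₁ s)
      (Real.exp (c * τ) * (c * x τ + x' τ - h τ)) τ := fun t ht => by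
    have h1 := ((hasDerivAt_id' t).const_mul c).exp
    refine ((h1.mul (hx t ht)).sub (hcI.integral_hasStrictDerivAt τ₀ t).hasDerivAt).congr_deriv ?_
    rw [he t ht]
    ring
  have hanti := antitoneOn_of_hasDerivAt_nonpos hd fun t ht =>
    mul_nonpos_of_nonneg_of_nonpos (Real.exp_pos _).le (by linarith [hle t ht])
  have h1 := hanti self_mem_Ici (mem_Ici.2 hτ) hτ
  simp only [intervalIntegral.integral_same, sub_zero] at h1
  have h2 : ∫ s in τ₀..τ, Real.exp (-c * (τ - s)) * h s =
      Real.exp (-c * τ) * ∫ s in τ₀..τ, Real.exp (c * s) * h₁ s := by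
    rw [← intervalIntegral.integral_const_mul]
    refine intervalIntegral.integral_congr fun s hs => ?_
    rw [uIcc_of_le hτ] at hs
    rw [he s hs.1, ← mul_assoc, ← Real.exp_add]
    ring_nf
  rw [h2]
  calc x τ = Real.exp (-c * τ) * (Real.exp (c * τ) * x τ) := by
        rw [← mul_assoc, ← Real.exp_add]
        simp
    _ ≤ Real.exp (-c * τ) * (Real.exp (c * τ₀) * x τ₀ + ∫ s in τ₀..τ, Real.exp (c * s) * h₁ s) := by
        gcongr
        linarith
    _ = _ := by
        rw [mul_add, ← mul_assoc, ← Real.exp_add]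
        ring_nf

/-- Grönwall's inequality for `x' ≤ -c x + B`. -/
theorem le_of_deriv_le_const {c B τ₀ : ℝ} (hc : 0 < c) {x x' : ℝ → ℝ}
    (hx : ∀ τ ≥ τ₀, HasDerivAt x (x' τ) τ) (hle : ∀ τ ≥ τ₀, x' τ ≤ -c * x τ + B)
    {τ : ℝ} (hτ : τ₀ ≤ τ) :
    x τ - B / c ≤ Real.exp (-c * (τ - τ₀)) * (x τ₀ - B / c) := by
  have := le_of_deriv_le (c := c) (h := fun _ => 0) (x := fun t => x t - B / c) (x' := x')
    (fun t ht => (hx t ht).sub_const _) (fun t ht => ?_) continuousOn_const hτ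
  · simpa using this
  · have h1 : -c * (x t - B / c) + 0 = -c * x t + B := by field_simp; ring
    rw [h1]
    exact hle t ht

/-- Once the forcing is below cε/2, the excess of x over ε/2 is bounded by a decaying exponential.
-/
theorem tendsto_zero_of_deriv_le {c τ₀ : ℝ} (hc : 0 < c) {x x' h : ℝ → ℝ}
    (hx : ∀ τ ≥ τ₀, HasDerivAt x (x' τ) τ) (hle : ∀ τ ≥ τ₀, x' τ ≤ -c * x τ + h τ)
    (hx0 : ∀ τ ≥ τ₀, 0 ≤ x τ) (hh : Tendsto h atTop (𝓝 0)) : Tendsto x atTop (𝓝 0) := by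
  rw [Metric.tendsto_atTop]
  intro ε hε
  obtain ⟨τ₁, hτ₁⟩ := eventually_atTop.1 ((hh.eventually (gt_mem_nhds
    (show (0 : ℝ) < c * (ε / 2) by positivity))).and (eventually_ge_atTop τ₀))
  have h1 : ∀ τ ≥ τ₁, x τ - ε / 2 ≤ Real.exp (-c * (τ - τ₁)) * (x τ₁ - ε / 2) := by
    intro τ hτ
    have h0 := le_of_deriv_le_const (B := c * (ε / 2)) hc (fun t ht => hx t (hτ₁ t ht).2)
      (fun t ht => ?_) hτ
    · rwa [mul_div_cancel_left₀ _ hc.ne'] at h0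
    · have := hle t (hτ₁ t ht).2
      linarith [(hτ₁ t ht).1]
  have h2 : Tendsto (fun τ => Real.exp (-c * (τ - τ₁)) * (x τ₁ - ε / 2)) atTop (𝓝 0) := by
    have h3 : Tendsto (fun τ => -c * (τ - τ₁)) atTop atBot :=
      (tendsto_atTop_add_const_right _ _ tendsto_id).const_mul_atTop_of_neg (by linarith)
    simpa using (Real.tendsto_exp_atBot.comp h3).mul_const (x τ₁ - ε / 2)
  obtain ⟨τ₂, hτ₂⟩ := eventually_atTop.1 (h2.eventually (gt_mem_nhds (half_pos hε)))
  refine ⟨max τ₁ τ₂, fun τ hτ => ?_⟩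
  have h3 := h1 τ ((le_max_left _ _).trans hτ)
  have h4 := hτ₂ τ ((le_max_right _ _).trans hτ)
  rw [Real.dist_eq, sub_zero, abs_of_nonneg (hx0 τ (hτ₁ τ ((le_max_left _ _).trans hτ)).2)]
  linarith

/-- A uniform bound for `x' = -c x + n` with bounded right-hand side. -/
theorem norm_le_of_hasDerivAt {c : ℂ} (hc : 0 < c.re) {τ₀ B : ℝ} {x n : ℝ → ℂ}
    (hx : ∀ τ ≥ τ₀, HasDerivAt x (-c * x τ + n τ) τ) (hn : ContinuousOn n (Ici τ₀))
    (hB : ∀ τ ≥ τ₀, ‖n τ‖ ≤ B) {τ : ℝ} (hτ : τ₀ ≤ τ) : ‖x τ‖ ≤ ‖x τ₀‖ + B / c.re := by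
  obtain ⟨M, h0, hM⟩ := exists_majorant hx hn
  have h1 := le_of_deriv_le_const (B := B) hc (fun t ht => (hM t ht).1)
    (fun t ht => by linarith [hB t ht]) hτ
  have hB0 : 0 ≤ B / c.re := div_nonneg ((norm_nonneg _).trans (hB τ₀ le_rfl)) hc.le
  have h2 : Real.exp (-c.re * (τ - τ₀)) ≤ 1 := by
    rw [Real.exp_le_one_iff]
    nlinarith
  have h3 := Real.exp_pos (-c.re * (τ - τ₀))
  have h4 : Real.exp (-c.re * (τ - τ₀)) * (M τ₀ - B / c.re) ≤ M τ₀ := by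
    have : 0 ≤ M τ₀ := by rw [h0]; positivity
    nlinarith
  linarith [(hM τ hτ).2]

/-! ### Small global solutions by contraction -/

/-- Bounds for the second order equation with characteristic roots `-μ`, `-ν`, written as a
triangular system. -/
theorem exists_bound_triangular {μ ν : ℂ} (hμ : 0 < μ.re) (hν : 0 < ν.re) :
    ∃ C > 0, ∀ (τ₀ D B : ℝ) (θ w n : ℝ → ℂ), 0 ≤ D →
      (∀ τ ≥ τ₀, HasDerivAt θ (-μ * θ τ + w τ) τ) → (∀ τ ≥ τ₀, HasDerivAt w (-ν * w τ + n τ) τ) →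
      ContinuousOn n (Ici τ₀) → (∀ τ ≥ τ₀, ‖n τ‖ ≤ B) → ‖θ τ₀‖ ≤ D → ‖w τ₀‖ ≤ (1 + ‖μ‖) * D →
      ∀ τ ≥ τ₀, ‖θ τ‖ + ‖-μ * θ τ + w τ‖ ≤ C * (D + B) := by
  set m := 1 + ‖μ‖ with hm
  have hm1 : 1 ≤ m := by have := norm_nonneg μ; linarith
  set K := m + 1 / ν.re with hK
  have hK0 : 0 < K := by positivity
  refine ⟨m * (1 + K / μ.re) + K, by positivity, ?_⟩
  intro τ₀ D B θ w n hD hθ hw hn hB hθ0 hw0 τ hτ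
  have hB0 : 0 ≤ B := (norm_nonneg _).trans (hB τ₀ le_rfl)
  have h1 : ∀ t ≥ τ₀, ‖w t‖ ≤ K * (D + B) := fun t ht => by
    have := norm_le_of_hasDerivAt hν hw hn hB ht
    have h2 : 0 ≤ 1 / ν.re * D := by positivity
    have h3 : 0 ≤ m * B := by positivity
    have h4 : B / ν.re = 1 / ν.re * B := by ring
    rw [hK]
    nlinarith
  have h2 : ‖θ τ‖ ≤ (1 + K / μ.re) * (D + B) := by
    have := norm_le_of_hasDerivAt hμ hθ
      (fun t ht => (hw t ht).continuousAt.continuousWithinAt) h1 hτ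
    have h4 : K * (D + B) / μ.re = K / μ.re * (D + B) := by ring
    linarith
  have h3 : ‖-μ * θ τ + w τ‖ ≤ ‖μ‖ * ‖θ τ‖ + ‖w τ‖ := by
    have := norm_add_le (-μ * θ τ) (w τ)
    simpa using this
  have h4 := h1 τ hτ
  have h5 : m * ‖θ τ‖ ≤ m * ((1 + K / μ.re) * (D + B)) := by gcongr
  have h6 : m * ‖θ τ‖ = ‖θ τ‖ + ‖μ‖ * ‖θ τ‖ := by rw [hm]; ring
  linarith

/-- Small data give a small global solution of `θ'' + a θ' + b θ = N(τ, θ, θ')` when `N` has a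
small Lipschitz constant. -/
theorem exists_small_solution {μ ν : ℂ} {a b : ℝ} (hμ : 0 < μ.re) (hν : 0 < ν.re)
    (hadd : μ + ν = a) (hmul : μ * ν = b) :
    ∃ C > 0, ∀ (τ₀ δ κ η α β : ℝ) (Nl : ℝ → ℝ → ℝ → ℝ), 0 < δ → 0 ≤ κ →
      (∀ x y : ℝ → ℝ, Continuous x → Continuous y → (∀ τ, |x τ| ≤ δ) → (∀ τ, |y τ| ≤ δ) →
        ContinuousOn (fun τ => Nl τ (x τ) (y τ)) (Ici τ₀)) →
      (∀ τ ≥ τ₀, ∀ x x' y y', |x| ≤ δ → |x'| ≤ δ → |y| ≤ δ → |y'| ≤ δ →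
        |Nl τ x y - Nl τ x' y'| ≤ κ * (|x - x'| + |y - y'|)) →
      (∀ τ ≥ τ₀, |Nl τ 0 0| ≤ η) → C * κ ≤ 1 / 8 → C * η ≤ δ / 4 → C * (|α| + |β|) ≤ δ / 4 →
      ∃ θ y n : ℝ → ℝ, Continuous n ∧ θ τ₀ = α ∧ y τ₀ = β ∧
        (∀ τ, HasDerivAt θ (y τ) τ) ∧ (∀ τ, HasDerivAt y (-a * y τ - b * θ τ + n τ) τ) ∧
        ∀ τ ≥ τ₀, n τ = Nl τ (θ τ) (y τ) ∧ |θ τ| ≤ δ ∧ |y τ| ≤ δ := by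
  obtain ⟨C, hC, hbd⟩ := exists_bound_triangular hμ hν
  refine ⟨C, hC, ?_⟩
  intro τ₀ δ κ η α β Nl hδ hκ hcont hlip hη hCκ hCη hCD
  -- The fixed-point unknown is the forcing n. Given n, two Duhamel formulas solve (d/dτ + ν)w = n
  -- and (d/dτ + μ)Θ = w; the initial value β + μα is that of w = θ' + μθ.
  let w : (BoundedContinuousFunction ℝ ℝ) → ℝ → ℂ := fun n =>
    duhamel ν τ₀ (β + μ * α) fun τ => (n τ : ℂ)
  have hw : ∀ n τ, HasDerivAt (w n) (-ν * w n τ + (n τ : ℂ)) τ := fun n τ =>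
    hasDerivAt_duhamel ν τ₀ _ (Complex.continuous_ofReal.comp n.continuous) τ
  have hwc : ∀ n, Continuous (w n) := fun n =>
    continuous_iff_continuousAt.2 fun τ => (hw n τ).continuousAt
  let Θ : (BoundedContinuousFunction ℝ ℝ) → ℝ → ℂ := fun n => duhamel μ τ₀ α (w n)
  have hΘ : ∀ n τ, HasDerivAt (Θ n) (-μ * Θ n τ + w n τ) τ := fun n τ =>
    hasDerivAt_duhamel μ τ₀ _ (hwc n) τ
  have hΘc : ∀ n, Continuous (Θ n) := fun n =>
    continuous_iff_continuousAt.2 fun τ => (hΘ n τ).continuousAt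
  -- The roots may be complex, but a, b and n are real, so real parts solve the same second-order
  -- equation.
  let X : (BoundedContinuousFunction ℝ ℝ) → ℝ → ℝ := fun n τ => (Θ n τ).re
  let Y : (BoundedContinuousFunction ℝ ℝ) → ℝ → ℝ := fun n τ => (-μ * Θ n τ + w n τ).re
  have hXc : ∀ n, Continuous (X n) := fun n => Complex.continuous_re.comp (hΘc n)
  have hYc : ∀ n, Continuous (Y n) := fun n =>
    Complex.continuous_re.comp ((continuous_const.mul (hΘc n)).add (hwc n))
  have hXd : ∀ n τ, HasDerivAt (X n) (Y n τ) τ := fun n τ => by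
    have := (Complex.reCLM.hasFDerivAt (x := Θ n τ)).comp_hasDerivAt τ (hΘ n τ)
    simpa [X, Y] using! this
  have hYd : ∀ n τ, HasDerivAt (Y n) (-a * Y n τ - b * X n τ + n τ) τ := fun n τ => by
    have h1 := ((hΘ n τ).const_mul (-μ)).add (hw n τ)
    have h2 := (Complex.reCLM.hasFDerivAt (x := -μ * Θ n τ + w n τ)).comp_hasDerivAt τ h1
    refine (show HasDerivAt (Y n) _ τ from h2).congr_deriv ?_
    have h3 : -μ * (-μ * Θ n τ + w n τ) + (-ν * w n τ + (n τ : ℂ)) =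
        -(a : ℂ) * (-μ * Θ n τ + w n τ) - b * Θ n τ + n τ := by
      rw [← hadd, ← hmul]
      ring
    rw [Complex.reCLM_apply, h3]
    simp [X, Y]
  have hsize : ∀ (n : BoundedContinuousFunction ℝ ℝ) (B : ℝ), (∀ τ ≥ τ₀, |n τ| ≤ B) →
      ∀ τ ≥ τ₀, |X n τ| + |Y n τ| ≤ C * (|α| + |β| + B) := by
    intro n B hB τ hτ
    have h1 := hbd τ₀ (|α| + |β|) B (Θ n) (w n) (fun τ => (n τ : ℂ)) (by positivity)
      (fun t _ => hΘ n t) (fun t _ => hw n t)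
      (Complex.continuous_ofReal.comp n.continuous).continuousOn (fun t ht => by simpa using hB t ht)
      ?_ ?_ τ hτ
    · exact (add_le_add (Complex.abs_re_le_norm _) (Complex.abs_re_le_norm _)).trans h1
    · simp only [Θ, duhamel_self]
      simp
    · simp only [w, duhamel_self]
      refine (norm_add_le _ _).trans ?_
      rw [norm_mul]
      simp only [Complex.norm_real, Real.norm_eq_abs]
      have := norm_nonneg μ
      have := abs_nonneg α
      have := abs_nonneg β
      nlinarith [mul_nonneg (norm_nonneg μ) (abs_nonneg β)]
  have hdiff : ∀ (n n' : BoundedContinuousFunction ℝ ℝ), ∀ τ ≥ τ₀,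
      |X n τ - X n' τ| + |Y n τ - Y n' τ| ≤ C * dist n n' := by
    intro n n' τ hτ
    have h1 := hbd τ₀ 0 (dist n n') (fun τ => Θ n τ - Θ n' τ) (fun τ => w n τ - w n' τ)
      (fun τ => (n τ : ℂ) - n' τ) le_rfl
      (fun t _ => ((hΘ n t).sub (hΘ n' t)).congr_deriv (by ring))
      (fun t _ => ((hw n t).sub (hw n' t)).congr_deriv (by ring))
      ((Complex.continuous_ofReal.comp n.continuous).sub
        (Complex.continuous_ofReal.comp n'.continuous)).continuousOn
      (fun t _ => by
        rw [← Complex.ofReal_sub, Complex.norm_real, ← dist_eq_norm]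
        exact BoundedContinuousFunction.dist_coe_le_dist t)
      (by simp [Θ, duhamel_self]) (by simp [w, duhamel_self]) τ hτ
    rw [zero_add] at h1
    refine (add_le_add ?_ ?_).trans h1
    · simp only [X]
      rw [← Complex.sub_re]
      exact Complex.abs_re_le_norm _
    · simp only [Y]
      rw [← Complex.sub_re]
      refine (Complex.abs_re_le_norm _).trans (le_of_eq ?_)
      congr 1
      ring
  -- Truncation to [-δ, δ] makes the map defined on the whole space of forcings. The a priori bound
  -- `hsm` shows afterwards that it is inactive at the fixed point.
  let cl : ℝ → ℝ := fun x => max (-δ) (min δ x)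
  have hclc : Continuous cl := by fun_prop
  have hcl : ∀ x, |cl x| ≤ δ := fun x =>
    abs_le.2 ⟨le_max_left _ _, max_le (by linarith) (min_le_left _ _)⟩
  have hcl_lip : ∀ x x', |cl x - cl x'| ≤ |x - x'| := fun x x' => by
    refine (abs_max_sub_max_le_max _ _ _ _).trans ?_
    simp only [sub_self, abs_zero]
    refine max_le (abs_nonneg _) ((abs_min_sub_min_le_max _ _ _ _).trans ?_)
    simp
  have hcl_id : ∀ x, |x| ≤ δ → cl x = x := fun x hx => by
    rw [abs_le] at hx
    simp [cl, hx.1, hx.2]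
  let T₀ : (BoundedContinuousFunction ℝ ℝ) → ℝ → ℝ := fun n τ =>
    Nl (max τ τ₀) (cl (X n (max τ τ₀))) (cl (Y n (max τ τ₀)))
  have hT₀b : ∀ n τ, |T₀ n τ| ≤ η + κ * (δ + δ) := by
    intro n τ
    have hm : max τ τ₀ ≥ τ₀ := le_max_right _ _
    have h1 := hlip _ hm (cl (X n (max τ τ₀))) 0 (cl (Y n (max τ τ₀))) 0 (hcl _) (by simpa using hδ.le)
      (hcl _) (by simpa using hδ.le)
    rw [sub_zero, sub_zero] at h1
    have h2 := hη _ hm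
    have h3 : κ * (|cl (X n (max τ τ₀))| + |cl (Y n (max τ τ₀))|) ≤ κ * (δ + δ) := by
      gcongr <;> exact hcl _
    have h4 := abs_sub_abs_le_abs_sub (T₀ n τ) (Nl (max τ τ₀) 0 0)
    have h5 : |T₀ n τ - Nl (max τ τ₀) 0 0| ≤ κ * (δ + δ) := h1.trans h3
    linarith
  have hT₀c : ∀ n, Continuous (T₀ n) := fun n =>
    (hcont (fun τ => cl (X n τ)) (fun τ => cl (Y n τ)) (hclc.comp (hXc n)) (hclc.comp (hYc n))
      (fun _ => hcl _) (fun _ => hcl _)).comp_continuous (by fun_prop) fun τ => mem_Ici.2 (le_max_right _ _)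
  let T : BoundedContinuousFunction ℝ ℝ → BoundedContinuousFunction ℝ ℝ := fun n =>
    BoundedContinuousFunction.ofNormedAddCommGroup (T₀ n) (hT₀c n) (η + κ * (δ + δ)) (hT₀b n)
  have hT : ContractingWith (1 / 2) T := by
    refine ⟨by
      rw [← NNReal.coe_lt_coe]
      norm_num, LipschitzWith.of_dist_le_mul fun n n' => ?_⟩
    rw [BoundedContinuousFunction.dist_le (by positivity)]
    intro τ
    have hm : max τ τ₀ ≥ τ₀ := le_max_right _ _
    have h1 := hlip _ hm _ _ _ _ (hcl (X n (max τ τ₀))) (hcl (X n' (max τ τ₀)))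
      (hcl (Y n (max τ τ₀))) (hcl (Y n' (max τ τ₀)))
    have h2 := hdiff n n' _ hm
    have h3 : dist (T n τ) (T n' τ) ≤ κ * (C * dist n n') := by
      rw [Real.dist_eq]
      refine h1.trans (mul_le_mul_of_nonneg_left (le_trans ?_ h2) hκ)
      exact add_le_add (hcl_lip _ _) (hcl_lip _ _)
    have h4 : 0 ≤ dist n n' := dist_nonneg
    push_cast
    nlinarith
  set n := hT.fixedPoint with hn
  have hfix : ∀ τ, n τ = T₀ n τ := fun τ => by
    have : T n = n := hT.fixedPoint_isFixedPt
    nth_rewrite 1 [← this]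
    rfl
  have hsm : ∀ τ ≥ τ₀, |X n τ| + |Y n τ| ≤ δ := by
    intro τ hτ
    -- Initial data, η and 2κδ each contribute at most δ/4 after multiplication by C.
    have := hsize n _ (fun t _ => by rw [hfix]; exact hT₀b n t) τ hτ
    nlinarith
  refine ⟨X n, Y n, n, n.continuous, ?_, ?_, hXd n, hYd n, fun τ hτ => ?_⟩
  · simp [X, Θ, duhamel_self]
  · simp [Y, Θ, w, duhamel_self]
  · have h1 := hsm τ hτ
    have h2 : |X n τ| ≤ δ := by linarith [abs_nonneg (Y n τ)]
    have h3 : |Y n τ| ≤ δ := by linarith [abs_nonneg (X n τ)]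
    refine ⟨?_, h2, h3⟩
    rw [hfix]
    simp only [T₀, max_eq_left hτ, hcl_id _ h2, hcl_id _ h3]

/-! ### Sharp decay of small solutions -/

set_option maxHeartbeats 1000000 in
/-- Sharp decay of the factor `θ' + μ θ` for small solutions of `θ'' + a θ' + b θ = n`, where
the right-hand side is controlled by the forcing `E`, by a faster decaying quantity `m` driven
by `E`, and by quadratic terms. -/
theorem exists_decay_factor {μ ν : ℂ} {a b lam κ₀ C₁ : ℝ} (hadd : μ + ν = a) (hmul : μ * ν = b)
    (hlam : 0 < lam) (hμ : lam ≤ μ.re) (hν : lam ≤ ν.re) (hκ₀ : lam < κ₀) (hC₁ : 0 < C₁) :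
    ∃ δ₀ > 0, ∀ (τ₀ : ℝ) (θ y n E m m' : ℝ → ℝ),
      (∀ τ ≥ τ₀, HasDerivAt θ (y τ) τ) →
      (∀ τ ≥ τ₀, HasDerivAt y (-a * y τ - b * θ τ + n τ) τ) →
      ContinuousOn n (Ici τ₀) → ContinuousOn E (Ici τ₀) → Tendsto E atTop (𝓝 0) →
      (∀ τ ≥ τ₀, HasDerivAt m (m' τ) τ) → (∀ τ ≥ τ₀, 0 ≤ m τ) →
      (∀ τ ≥ τ₀, m' τ ≤ -κ₀ * m τ + C₁ * |E τ|) →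
      (∀ τ ≥ τ₀, |n τ| ≤ C₁ * (|E τ| + m τ + (|θ τ| + |y τ|) ^ 2)) →
      (∀ τ ≥ τ₀, |θ τ| + |y τ| ≤ δ₀) →
      Tendsto (fun τ => |θ τ| + |y τ|) atTop (𝓝 0) ∧
      ∃ K > 0, ∃ τ₁ ≥ τ₀, ∀ τ ≥ τ₁, ‖(y τ + μ * θ τ : ℂ)‖ ≤
        K * (Real.exp (-lam * (τ - τ₀)) + ∫ s in τ₀..τ, Real.exp (-lam * (τ - s)) * |E s|) := by
  -- In Z = Mθ + L·Mv the weight L lets the decay of Mv absorb the coupling term ‖v‖ at a cost of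
  -- lam/8 in rate. The bound δ₀ makes the quadratic part of n cost another lam/8, which leaves Z
  -- with rate 3·lam/4.
  set L := 8 / lam + 1 with hL
  have hL0 : 0 < L := by positivity
  set M := 1 + ‖μ‖ with hM
  have hM0 : 0 < M := by positivity
  refine ⟨lam / (8 * L * C₁ * M), by positivity, ?_⟩
  set δ₀ := lam / (8 * L * C₁ * M) with hδ₀
  have hδ₀' : L * C₁ * δ₀ * M = lam / 8 := by rw [hδ₀]; field_simp
  have hδpos : 0 < δ₀ := by positivity
  intro τ₀ θ y n E m m' hθ hy hn hE hE0 hm hmnn hm' hnb hsmall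
  set v : ℝ → ℂ := fun τ => y τ + μ * θ τ with hv
  have hvd : ∀ τ ≥ τ₀, HasDerivAt v (-ν * v τ + (n τ : ℂ)) τ := fun τ hτ => by
    refine ((hy τ hτ).ofReal_comp.add ((hθ τ hτ).ofReal_comp.const_mul μ)).congr_deriv ?_
    push_cast
    rw [← hadd, ← hmul, hv]
    ring
  have hθd : ∀ τ ≥ τ₀, HasDerivAt (fun t => (θ t : ℂ)) (-μ * (θ τ : ℂ) + v τ) τ := fun τ hτ => by
    refine (hθ τ hτ).ofReal_comp.congr_deriv ?_
    rw [hv]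
    ring
  obtain ⟨Mv, -, hMv⟩ := exists_majorant hvd (Complex.continuous_ofReal.comp_continuousOn hn)
  obtain ⟨Mθ, -, hMθ⟩ := exists_majorant hθd fun τ hτ => (hvd τ hτ).continuousAt.continuousWithinAt
  have hMv0 : ∀ τ ≥ τ₀, 0 ≤ Mv τ := fun τ hτ => (norm_nonneg _).trans (hMv τ hτ).2
  have hMθ0 : ∀ τ ≥ τ₀, 0 ≤ Mθ τ := fun τ hτ => (norm_nonneg _).trans (hMθ τ hτ).2
  set Z : ℝ → ℝ := fun τ => Mθ τ + L * Mv τ with hZ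
  have hZ0 : ∀ τ ≥ τ₀, 0 ≤ Z τ := fun τ hτ =>
    add_nonneg (hMθ0 τ hτ) (mul_nonneg hL0.le (hMv0 τ hτ))
  have hYZ : ∀ τ ≥ τ₀, |θ τ| + |y τ| ≤ M * Z τ := fun τ hτ => by
    have h1 : |θ τ| ≤ Mθ τ := by simpa using (hMθ τ hτ).2
    have h2 : |y τ| ≤ ‖v τ‖ + ‖μ‖ * |θ τ| := by
      have h3 : (y τ : ℂ) = v τ - μ * θ τ := by rw [hv]; ring
      have h4 := norm_sub_le (v τ) (μ * θ τ)
      rw [← h3, norm_mul, Complex.norm_real, Complex.norm_real] at h4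
      exact h4
    have h3 : Mv τ ≤ L * Mv τ := by
      have : 0 < 8 / lam := by positivity
      nlinarith [hMv0 τ hτ]
    have h4 : ‖μ‖ * |θ τ| ≤ ‖μ‖ * Mθ τ := by gcongr
    have h5 : 0 ≤ ‖μ‖ * (L * Mv τ) := by have := hMv0 τ hτ; positivity
    have h6 := (hMv τ hτ).2
    simp only [hZ, hM]
    nlinarith
  set Z' : ℝ → ℝ := fun τ => (-μ.re * Mθ τ + ‖v τ‖) + L * (-ν.re * Mv τ + |n τ|) with hZ'
  have hZd : ∀ τ ≥ τ₀, HasDerivAt Z (Z' τ) τ := fun τ hτ => by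
    have h1 := (hMv τ hτ).1
    rw [Complex.norm_real] at h1
    exact (hMθ τ hτ).1.add (h1.const_mul L)
  have hZle : ∀ τ ≥ τ₀, Z' τ ≤ -(3 * lam / 4) * Z τ + L * C₁ * (|E τ| + m τ) := fun τ hτ => by
    have h1 := hMv0 τ hτ
    have h2 := hMθ0 τ hτ
    have h3 := (hMv τ hτ).2
    have h4 : (|θ τ| + |y τ|) ^ 2 ≤ δ₀ * (M * Z τ) := by
      rw [sq]
      exact mul_le_mul (hsmall τ hτ) (hYZ τ hτ) (by positivity) hδpos.le
    have h5 : L * |n τ| ≤ L * C₁ * (|E τ| + m τ) + lam / 8 * Z τ := by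
      calc L * |n τ| ≤ L * (C₁ * (|E τ| + m τ + δ₀ * (M * Z τ))) := by
            refine mul_le_mul_of_nonneg_left ((hnb τ hτ).trans ?_) hL0.le
            gcongr
        _ = L * C₁ * (|E τ| + m τ) + (L * C₁ * δ₀ * M) * Z τ := by ring
        _ = _ := by rw [hδ₀']
    have h6 : Mv τ ≤ lam / 8 * (L * Mv τ) := by
      rw [hL]
      have : lam / 8 * ((8 / lam + 1) * Mv τ) = Mv τ + lam / 8 * Mv τ := by field_simp
      rw [this]
      have : 0 ≤ lam / 8 * Mv τ := by positivity
      linarith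
    have h7 : lam * Mθ τ ≤ μ.re * Mθ τ := by gcongr
    have h8 : lam * (L * Mv τ) ≤ ν.re * (L * Mv τ) := by gcongr
    have h9 : 0 ≤ lam / 8 * Mθ τ := by positivity
    simp only [hZ', hZ] at h5 ⊢
    nlinarith
  have hm0 : Tendsto m atTop (𝓝 0) := by
    refine tendsto_zero_of_deriv_le (hlam.trans hκ₀) hm hm' hmnn ?_
    simpa using hE0.abs.const_mul C₁
  have hZlim : Tendsto Z atTop (𝓝 0) := by
    refine tendsto_zero_of_deriv_le (show 0 < 3 * lam / 4 by positivity) hZd hZle hZ0 ?_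
    simpa using (hE0.abs.add hm0).const_mul (L * C₁)
  refine ⟨?_, ?_⟩
  · refine squeeze_zero' (Eventually.of_forall fun τ => by positivity) ?_
      (by simpa using hZlim.const_mul M)
    filter_upwards [eventually_ge_atTop τ₀] with τ hτ using hYZ τ hτ
  obtain ⟨τ₁, hτ₁⟩ := eventually_atTop.1
    ((hZlim.eventually (gt_mem_nhds one_pos)).and (eventually_ge_atTop τ₀))
  have h01 : τ₀ ≤ τ₁ := (hτ₁ τ₁ le_rfl).2
  -- The functional W = Mv + K₁Z² + K₂m recovers the full rate lam. Since Z² decays at rate 3·lam/2,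
  -- K₁Z² has spare dissipation (K₁·lam/2)Z² = C₁M²Z², which cancels the quadratic part of n. The
  -- spare dissipation K₂(κ₀ - lam)m cancels all terms in m; past τ₁ one has Z < 1, so the cross
  -- term Z·m is at most m. Only C₄|E| is left as forcing.
  set K₁ := 2 * C₁ * M ^ 2 / lam with hK₁
  have hK₁0 : 0 < K₁ := by positivity
  set K₂ := (C₁ + 2 * K₁ * L * C₁) / (κ₀ - lam) with hK₂
  have hκl : 0 < κ₀ - lam := by linarith
  have hK₂0 : 0 < K₂ := by positivity
  set C₄ := C₁ + 2 * K₁ * L * C₁ + K₂ * C₁ with hC₄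
  have hC₄0 : 0 < C₄ := by positivity
  set W : ℝ → ℝ := fun τ => Mv τ + K₁ * Z τ ^ 2 + K₂ * m τ with hW
  set W' : ℝ → ℝ := fun τ => (-ν.re * Mv τ + |n τ|) + K₁ * (2 * Z τ * Z' τ) + K₂ * m' τ with hW'
  have hWd : ∀ τ ≥ τ₁, HasDerivAt W (W' τ) τ := fun τ hτ => by
    have hτ' := (hτ₁ τ hτ).2
    have h1 := (hMv τ hτ').1
    rw [Complex.norm_real] at h1
    refine ((h1.add (((hZd τ hτ').pow 2).const_mul K₁)).add ((hm τ hτ').const_mul K₂)).congr_deriv ?_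
    simp [hW']
  have hWle : ∀ τ ≥ τ₁, W' τ ≤ -lam * W τ + C₄ * |E τ| := fun τ hτ => by
    obtain ⟨hZ1, hτ'⟩ := hτ₁ τ hτ
    have h1 := hMv0 τ hτ'
    have h2 := hZ0 τ hτ'
    have h3 := hmnn τ hτ'
    have h4 : |n τ| ≤ C₁ * (|E τ| + m τ + (M * Z τ) ^ 2) := by
      refine (hnb τ hτ').trans ?_
      have := hYZ τ hτ'
      gcongr
    have h5 : 2 * Z τ * Z' τ ≤ -(3 * lam / 2) * Z τ ^ 2 + 2 * (L * C₁ * (|E τ| + m τ)) := by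
      have h6 : 2 * Z τ * Z' τ ≤
          2 * Z τ * (-(3 * lam / 4) * Z τ + L * C₁ * (|E τ| + m τ)) :=
        mul_le_mul_of_nonneg_left (hZle τ hτ') (by positivity)
      have h7 : Z τ * (L * C₁ * (|E τ| + m τ)) ≤ 1 * (L * C₁ * (|E τ| + m τ)) :=
        mul_le_mul_of_nonneg_right hZ1.le (by positivity)
      nlinarith
    have h6 := mul_le_mul_of_nonneg_left h5 hK₁0.le
    have h7 := mul_le_mul_of_nonneg_left (hm' τ hτ') hK₂0.le
    have h8 : K₁ * lam = 2 * (C₁ * M ^ 2) := by rw [hK₁]; field_simp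
    have h9 : K₂ * κ₀ = K₂ * lam + (C₁ + 2 * K₁ * L * C₁) := by
      have : K₂ * (κ₀ - lam) = C₁ + 2 * K₁ * L * C₁ := by rw [hK₂]; field_simp
      linarith
    have h10 : lam * Mv τ ≤ ν.re * Mv τ := by gcongr
    have e1 : K₁ * (-(3 * lam / 2) * Z τ ^ 2 + 2 * (L * C₁ * (|E τ| + m τ))) =
        -lam * (K₁ * Z τ ^ 2) - C₁ * (M * Z τ) ^ 2 + 2 * K₁ * L * C₁ * (|E τ| + m τ) := by
      linear_combination (-(1 / 2) * Z τ ^ 2) * h8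
    have e2 : K₂ * (-κ₀ * m τ + C₁ * |E τ|) =
        -lam * (K₂ * m τ) - (C₁ + 2 * K₁ * L * C₁) * m τ + K₂ * C₁ * |E τ| := by
      linear_combination (-m τ) * h9
    rw [e1] at h6
    rw [e2] at h7
    simp only [hW', hW, hC₄]
    linarith
  have hEa : ContinuousOn (fun τ => |E τ|) (Ici τ₀) := hE.abs
  -- The exponential factor moves the initial time of the homogeneous term from τ₁ back to τ₀.
  refine ⟨max C₄ (W τ₁ * Real.exp (lam * (τ₁ - τ₀))) , lt_max_of_lt_left hC₄0, τ₁, h01, ?_⟩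
  intro τ hτ
  obtain ⟨-, hτ'⟩ := hτ₁ τ hτ
  set I := ∫ s in τ₀..τ, Real.exp (-lam * (τ - s)) * |E s| with hI
  have hint : ∀ t₁ t₂, τ₀ ≤ t₁ → t₁ ≤ t₂ → IntervalIntegrable
      (fun s => Real.exp (-lam * (τ - s)) * |E s|) MeasureTheory.volume t₁ t₂ := by
    intro t₁ t₂ h1 h2
    refine ContinuousOn.intervalIntegrable ?_
    rw [uIcc_of_le h2]
    refine ContinuousOn.mul (by fun_prop) (hEa.mono fun t ht => h1.trans ht.1)
  have h1 := le_of_deriv_le hWd hWle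
    (continuousOn_const.mul (hEa.mono fun t ht => h01.trans ht)) hτ
  have h2 : ∫ s in τ₁..τ, Real.exp (-lam * (τ - s)) * (C₄ * |E s|) ≤ C₄ * I := by
    have h3 : ∀ s, Real.exp (-lam * (τ - s)) * (C₄ * |E s|) =
        C₄ * (Real.exp (-lam * (τ - s)) * |E s|) := fun s => by ring
    simp only [h3]
    rw [intervalIntegral.integral_const_mul]
    refine mul_le_mul_of_nonneg_left ?_ hC₄0.le
    rw [hI, ← intervalIntegral.integral_add_adjacent_intervals (hint τ₀ τ₁ le_rfl h01)
      (hint τ₁ τ h01 hτ)]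
    have : 0 ≤ ∫ s in τ₀..τ₁, Real.exp (-lam * (τ - s)) * |E s| :=
      intervalIntegral.integral_nonneg h01 fun s _ => by positivity
    linarith
  have hI0 : 0 ≤ I := intervalIntegral.integral_nonneg hτ' fun s _ => by positivity
  have h3 : ‖v τ‖ ≤ W τ := by
    have := (hMv τ hτ').2
    have := hZ0 τ hτ'
    have := hmnn τ hτ'
    have h4 : 0 ≤ K₁ * Z τ ^ 2 + K₂ * m τ := by positivity
    simp only [hW]
    linarith
  calc ‖v τ‖ ≤ Real.exp (-lam * (τ - τ₁)) * W τ₁ + C₄ * I := by linarith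
    _ = (W τ₁ * Real.exp (lam * (τ₁ - τ₀))) * Real.exp (-lam * (τ - τ₀)) + C₄ * I := by
      rw [mul_assoc, ← Real.exp_add]
      ring_nf
    _ ≤ _ := by
      rw [mul_add]
      gcongr
      · exact le_max_right _ _
      · exact le_max_left _ _

/-- Integration of the factored equation in the case of a double root. -/
theorem exists_decay_double {lam K τ₀ τ₁ : ℝ} (h01 : τ₀ ≤ τ₁) {θ w E : ℝ → ℝ}
    (hθ : ∀ τ ≥ τ₁, HasDerivAt θ (-lam * θ τ + w τ) τ) (hw : ContinuousOn w (Ici τ₁))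
    (hE : ContinuousOn E (Ici τ₀))
    (hle : ∀ τ ≥ τ₁, |w τ| ≤
      K * (Real.exp (-lam * (τ - τ₀)) + ∫ s in τ₀..τ, Real.exp (-lam * (τ - s)) * |E s|)) :
    ∃ K' > 0, ∀ τ ≥ τ₁, |θ τ| ≤ K' * ((1 + (τ - τ₀)) * Real.exp (-lam * (τ - τ₀)) +
      ∫ s in τ₀..τ, ((1 + (τ - s)) * Real.exp (-lam * (τ - s))) * |E s|) := by
  obtain ⟨M, -, hM⟩ := exists_majorant_real hθ hw
  set e : ℝ → ℝ := fun τ => |E (max τ τ₀)| with he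
  have hec : Continuous e :=
    (hE.comp_continuous (by fun_prop) fun τ => mem_Ici.2 (le_max_right _ _)).abs
  have hee : ∀ τ ≥ τ₀, e τ = |E τ| := fun τ hτ => by simp only [he, max_eq_left hτ]
  -- The convolution with (1+t)e^{-lam·t} is split into primitives A and B whose integrands do not
  -- involve τ, so that it can be differentiated by the fundamental theorem of calculus.
  set A : ℝ → ℝ := fun τ => ∫ s in τ₀..τ, Real.exp (lam * (s - τ₀)) * e s with hA
  set B : ℝ → ℝ := fun τ => ∫ s in τ₀..τ, s * (Real.exp (lam * (s - τ₀)) * e s) with hB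
  have hcA : Continuous fun s => Real.exp (lam * (s - τ₀)) * e s := by fun_prop
  have hcB : Continuous fun s => s * (Real.exp (lam * (s - τ₀)) * e s) := by fun_prop
  have hAd : ∀ τ, HasDerivAt A (Real.exp (lam * (τ - τ₀)) * e τ) τ := fun τ =>
    (hcA.integral_hasStrictDerivAt τ₀ τ).hasDerivAt
  have hBd : ∀ τ, HasDerivAt B (τ * (Real.exp (lam * (τ - τ₀)) * e τ)) τ := fun τ =>
    (hcB.integral_hasStrictDerivAt τ₀ τ).hasDerivAt
  set R : ℝ → ℝ := fun τ => Real.exp (-lam * (τ - τ₀)) * (1 + A τ) with hR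
  set J : ℝ → ℝ := fun τ => Real.exp (-lam * (τ - τ₀)) * ((1 + (τ - τ₀)) + ((1 + τ) * A τ - B τ))
    with hJ
  have hmulexp : ∀ τ s, Real.exp (-lam * (τ - τ₀)) * Real.exp (lam * (s - τ₀)) =
      Real.exp (-lam * (τ - s)) := fun τ s => by
    rw [← Real.exp_add]
    ring_nf
  have hReq : ∀ τ ≥ τ₀, Real.exp (-lam * (τ - τ₀)) +
      (∫ s in τ₀..τ, Real.exp (-lam * (τ - s)) * |E s|) = R τ := fun τ hτ => by
    simp only [hR, hA, mul_add, mul_one]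
    rw [← intervalIntegral.integral_const_mul]
    congr 1
    refine intervalIntegral.integral_congr fun s hs => ?_
    rw [uIcc_of_le hτ] at hs
    rw [hee s hs.1, ← mul_assoc, hmulexp]
  have hJeq : ∀ τ ≥ τ₀, (1 + (τ - τ₀)) * Real.exp (-lam * (τ - τ₀)) +
      (∫ s in τ₀..τ, ((1 + (τ - s)) * Real.exp (-lam * (τ - s))) * |E s|) = J τ := fun τ hτ => by
    have hcA' : Continuous fun s => (1 + τ) * (Real.exp (lam * (s - τ₀)) * e s) := by fun_prop
    simp only [hJ, hA, hB]
    rw [mul_add, ← intervalIntegral.integral_const_mul, ← intervalIntegral.integral_sub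
      (hcA'.intervalIntegrable _ _) (hcB.intervalIntegrable _ _),
      ← intervalIntegral.integral_const_mul, mul_comm (1 + (τ - τ₀))]
    congr 1
    refine intervalIntegral.integral_congr fun s hs => ?_
    rw [uIcc_of_le hτ] at hs
    rw [hee s hs.1, ← hmulexp τ s]
    ring
  have hJpos : 0 < J τ₁ := by
    rw [← hJeq τ₁ h01]
    have h1 : 0 ≤ ∫ s in τ₀..τ₁, ((1 + (τ₁ - s)) * Real.exp (-lam * (τ₁ - s))) * |E s| := by
      refine intervalIntegral.integral_nonneg h01 fun s hs => ?_
      have : 0 ≤ τ₁ - s := by linarith [hs.2]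
      positivity
    have h2 : 0 ≤ τ₁ - τ₀ := by linarith
    positivity
  have hJd : ∀ τ ≥ τ₁, HasDerivAt J (-lam * J τ + R τ + e τ) τ := fun τ _ => by
    have h1 := (((hasDerivAt_id' τ).sub_const τ₀).const_mul (-lam)).exp
    have h2 := (((hasDerivAt_id' τ).sub_const τ₀).const_add 1).fun_add
      ((((hasDerivAt_id' τ).const_add 1).fun_mul (hAd τ)).fun_sub (hBd τ))
    refine (h1.fun_mul h2).congr_deriv ?_
    have h3 : Real.exp (-lam * (τ - τ₀)) * Real.exp (lam * (τ - τ₀)) = 1 := by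
      rw [hmulexp]
      simp
    simp only [hR, hJ]
    linear_combination (e τ) * h3
  have hRnn : ∀ τ ≥ τ₁, 0 ≤ R τ := fun τ hτ => by
    have h0 : τ₀ ≤ τ := h01.trans hτ
    rw [← hReq τ h0]
    have : 0 ≤ ∫ s in τ₀..τ, Real.exp (-lam * (τ - s)) * |E s| :=
      intervalIntegral.integral_nonneg h0 fun s _ => by positivity
    positivity
  -- J solves J' = -lam·J + R + e with e ≥ 0, so K'J is a supersolution for the majorant M: K' ≥ K
  -- compares the forcings and K' ≥ M(τ₁)/J(τ₁) the initial values.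
  set K' := max (max K (M τ₁ / J τ₁)) 1 with hK'
  have hK1 : K ≤ K' := (le_max_left _ _).trans (le_max_left _ _)
  have hK2 : M τ₁ / J τ₁ ≤ K' := (le_max_right _ _).trans (le_max_left _ _)
  have hK3 : 0 < K' := lt_of_lt_of_le one_pos (le_max_right _ _)
  refine ⟨K', hK3, fun τ hτ => ?_⟩
  rw [hJeq τ (h01.trans hτ)]
  have h1 := le_of_deriv_le (c := lam) (h := fun _ => 0) (x := fun t => M t - K' * J t)
    (fun t ht => (hM t ht).1.fun_sub ((hJd t ht).const_mul K')) (fun t ht => ?_)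
    continuousOn_const hτ
  · have h2 : M τ₁ - K' * J τ₁ ≤ 0 := by
      rw [div_le_iff₀ hJpos] at hK2
      linarith
    have h3 : Real.exp (-lam * (τ - τ₁)) * (M τ₁ - K' * J τ₁) ≤ 0 :=
      mul_nonpos_of_nonneg_of_nonpos (Real.exp_pos _).le h2
    simp only [mul_zero, intervalIntegral.integral_zero] at h1
    linarith [(hM τ hτ).2]
  · have h2 := hle t ht
    rw [hReq t (h01.trans ht)] at h2
    have h3 : K * R t ≤ K' * R t := mul_le_mul_of_nonneg_right hK1 (hRnn t ht)
    have h4 : 0 ≤ K' * e t := mul_nonneg hK3.le (abs_nonneg _)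
    linarith

/-- The sharp decay profile of the Green function of `θ'' + a θ' + b θ`. -/
noncomputable def decayKernel (a b t : ℝ) : ℝ :=
  if 4 * b < a ^ 2 then Real.exp (-((a - √(a ^ 2 - 4 * b)) / 2) * t)
  else if a ^ 2 = 4 * b then (1 + t) * Real.exp (-(a / 2) * t)
  else Real.exp (-(a / 2) * t)

/-- Here -μ and -ν are the characteristic roots and `lam` is the smallest real part of μ, ν. The
alternative matters because the decay of θ is recovered by dividing by μ - ν when the roots differ,
and by one more integration when they coincide. -/
theorem exists_roots {a b : ℝ} (ha : 0 < a) (hb : 0 < b) :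
    ∃ (μ ν : ℂ) (lam : ℝ), μ + ν = a ∧ μ * ν = b ∧ 0 < lam ∧ lam ≤ μ.re ∧ lam ≤ ν.re ∧
      lam ≤ a / 2 ∧ ((μ ≠ ν ∧ ∀ t, decayKernel a b t = Real.exp (-lam * t)) ∨
        (μ = lam ∧ ν = lam ∧ ∀ t, decayKernel a b t = (1 + t) * Real.exp (-lam * t))) := by
  rcases lt_trichotomy (4 * b) (a ^ 2) with h | h | h
  · have hD : 0 < a ^ 2 - 4 * b := by linarith
    set r := √(a ^ 2 - 4 * b) with hr
    have hr0 : 0 < r := Real.sqrt_pos.2 hD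
    have hr2 : r ^ 2 = a ^ 2 - 4 * b := Real.sq_sqrt hD.le
    have hra : r < a := lt_of_pow_lt_pow_left₀ 2 ha.le (by linarith)
    refine ⟨((a - r) / 2 : ℝ), ((a + r) / 2 : ℝ), (a - r) / 2, ?_, ?_, by linarith, ?_, ?_,
      by linarith, Or.inl ⟨?_, fun t => ?_⟩⟩
    · push_cast; ring
    · rw [← Complex.ofReal_mul]
      congr 1
      linear_combination (-1 / 4) * hr2
    · rw [Complex.ofReal_re]
    · rw [Complex.ofReal_re]; linarith
    · intro h'
      have := Complex.ofReal_injective h'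
      linarith
    · rw [decayKernel, if_pos h]
  · refine ⟨(a / 2 : ℝ), (a / 2 : ℝ), a / 2, ?_, ?_, by linarith, ?_, ?_, le_rfl,
      Or.inr ⟨rfl, rfl, fun t => ?_⟩⟩
    · push_cast; ring
    · rw [← Complex.ofReal_mul]
      congr 1
      linarith
    · rw [Complex.ofReal_re]
    · rw [Complex.ofReal_re]
    · rw [decayKernel, if_neg (by linarith), if_pos h.symm]
  · have hD : 0 < 4 * b - a ^ 2 := by linarith
    set r := √(4 * b - a ^ 2) with hr
    have hr0 : 0 < r := Real.sqrt_pos.2 hD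
    have hr2 : r ^ 2 = 4 * b - a ^ 2 := Real.sq_sqrt hD.le
    refine ⟨⟨a / 2, r / 2⟩, ⟨a / 2, -(r / 2)⟩, a / 2, ?_, ?_, by linarith, le_rfl, le_rfl, le_rfl,
      Or.inl ⟨?_, fun t => ?_⟩⟩
    · apply Complex.ext <;> simp
    · apply Complex.ext
      · simp
        linear_combination (1 / 4) * hr2
      · simp
        ring
    · intro h'
      have := congrArg Complex.im h'
      simp only at this
      linarith
    · rw [decayKernel, if_neg (by linarith), if_neg (by linarith)]

theorem exp_le_of_nonneg {lam t : ℝ} (ht : 0 ≤ t) :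
    Real.exp (-lam * t) ≤ (1 + t) * Real.exp (-lam * t) := by
  nlinarith [mul_nonneg ht (Real.exp_pos (-lam * t)).le]

/-- Small data give a solution of `θ'' + a θ' + b θ = N(τ, θ, θ')` decaying at the sharp rate of
the linear equation. -/
theorem exists_decaying_solution {a b κ₀ C₁ : ℝ} (ha : 0 < a) (hb : 0 < b) (hκ₀ : a / 2 < κ₀)
    (hC₁ : 0 < C₁) :
    ∃ C > 0, ∃ δ₀ > 0, ∀ (τ₀ δ κ η α β : ℝ) (Nl : ℝ → ℝ → ℝ → ℝ) (E m m' : ℝ → ℝ),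
      0 < δ → δ ≤ δ₀ → 0 ≤ κ →
      (∀ x y : ℝ → ℝ, Continuous x → Continuous y → (∀ τ, |x τ| ≤ δ) → (∀ τ, |y τ| ≤ δ) →
        ContinuousOn (fun τ => Nl τ (x τ) (y τ)) (Ici τ₀)) →
      (∀ τ ≥ τ₀, ∀ x x' y y', |x| ≤ δ → |x'| ≤ δ → |y| ≤ δ → |y'| ≤ δ →
        |Nl τ x y - Nl τ x' y'| ≤ κ * (|x - x'| + |y - y'|)) →
      (∀ τ ≥ τ₀, |Nl τ 0 0| ≤ η) → C * κ ≤ 1 / 8 → C * η ≤ δ / 4 → C * (|α| + |β|) ≤ δ / 4 →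
      ContinuousOn E (Ici τ₀) → Tendsto E atTop (𝓝 0) →
      (∀ τ ≥ τ₀, HasDerivAt m (m' τ) τ) → (∀ τ ≥ τ₀, 0 ≤ m τ) →
      (∀ τ ≥ τ₀, m' τ ≤ -κ₀ * m τ + C₁ * |E τ|) →
      (∀ τ ≥ τ₀, ∀ x y, |x| ≤ δ → |y| ≤ δ →
        |Nl τ x y| ≤ C₁ * (|E τ| + m τ + (|x| + |y|) ^ 2)) →
      ∃ θ y n : ℝ → ℝ, Continuous n ∧ θ τ₀ = α ∧ y τ₀ = β ∧
        (∀ τ, HasDerivAt θ (y τ) τ) ∧ (∀ τ, HasDerivAt y (-a * y τ - b * θ τ + n τ) τ) ∧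
        (∀ τ ≥ τ₀, n τ = Nl τ (θ τ) (y τ) ∧ |θ τ| ≤ δ ∧ |y τ| ≤ δ) ∧
        Tendsto (fun τ => |θ τ| + |y τ|) atTop (𝓝 0) ∧
        ∃ K > 0, ∃ τ₁ ≥ τ₀, ∀ τ ≥ τ₁, |θ τ| + |y τ| ≤ K * (decayKernel a b (τ - τ₀) +
          ∫ s in τ₀..τ, decayKernel a b (τ - s) * |E s|) := by
  obtain ⟨μ, ν, lam, hadd, hmul, hlam, hμ, hν, hla, hker⟩ := exists_roots ha hb
  obtain ⟨C, hC, hex⟩ := exists_small_solution (hlam.trans_le hμ) (hlam.trans_le hν) hadd hmul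
  obtain ⟨δ₁, hδ₁, hdec₁⟩ := exists_decay_factor hadd hmul hlam hμ hν (hla.trans_lt hκ₀) hC₁
  -- Using the factorization in both orders bounds θ' + μθ and θ' + νθ; for distinct roots their
  -- difference (μ - ν)θ gives θ itself.
  obtain ⟨δ₂, hδ₂, hdec₂⟩ := exists_decay_factor ((add_comm ν μ).trans hadd)
    ((mul_comm ν μ).trans hmul) hlam hν hμ (hla.trans_lt hκ₀) hC₁
  refine ⟨C, hC, min δ₁ δ₂ / 2, by positivity, ?_⟩
  intro τ₀ δ κ η α β Nl E m m' hδ hδle hκ hcont hlip hη hCκ hCη hCD hE hE0 hm hm0 hm' hNl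
  obtain ⟨θ, y, n, hn, hα, hβ, hθ, hy, hall⟩ :=
    hex τ₀ δ κ η α β Nl hδ hκ hcont hlip hη hCκ hCη hCD
  have hnb : ∀ τ ≥ τ₀, |n τ| ≤ C₁ * (|E τ| + m τ + (|θ τ| + |y τ|) ^ 2) := fun τ hτ => by
    obtain ⟨h1, h2, h3⟩ := hall τ hτ
    rw [h1]
    exact hNl τ hτ _ _ h2 h3
  have hsm : ∀ τ ≥ τ₀, |θ τ| + |y τ| ≤ min δ₁ δ₂ := fun τ hτ => by
    obtain ⟨h1, h2, h3⟩ := hall τ hτ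
    linarith
  obtain ⟨hlim, K₁, hK₁, τ₁, hτ₁, hv₁⟩ := hdec₁ τ₀ θ y n E m m' (fun τ _ => hθ τ)
    (fun τ _ => hy τ) hn.continuousOn hE hE0 hm hm0 hm' hnb
    (fun τ hτ => (hsm τ hτ).trans (min_le_left _ _))
  obtain ⟨-, K₂, hK₂, τ₂, hτ₂, hv₂⟩ := hdec₂ τ₀ θ y n E m m' (fun τ _ => hθ τ)
    (fun τ _ => hy τ) hn.continuousOn hE hE0 hm hm0 hm' hnb
    (fun τ hτ => (hsm τ hτ).trans (min_le_right _ _))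
  refine ⟨θ, y, n, hn, hα, hβ, hθ, hy, hall, hlim, ?_⟩
  rcases hker with ⟨hne, hk⟩ | ⟨hμ', -, hk⟩
  · have hd : 0 < ‖μ - ν‖ := norm_pos_iff.2 (sub_ne_zero.2 hne)
    refine ⟨(1 + ‖μ‖) * ((K₁ + K₂) / ‖μ - ν‖) + K₁, by positivity, max τ₁ τ₂,
      hτ₁.trans (le_max_left _ _), fun τ hτ => ?_⟩
    have h1 := hv₁ τ ((le_max_left _ _).trans hτ)
    have h2 := hv₂ τ ((le_max_right _ _).trans hτ)
    simp only [hk]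
    set R := Real.exp (-lam * (τ - τ₀)) + ∫ s in τ₀..τ, Real.exp (-lam * (τ - s)) * |E s|
    have h3 : |θ τ| ≤ (K₁ + K₂) / ‖μ - ν‖ * R := by
      rw [div_mul_eq_mul_div, le_div_iff₀ hd]
      have h4 : (μ - ν) * θ τ = (y τ + μ * θ τ) - (y τ + ν * θ τ) := by ring
      have h5 := norm_sub_le (y τ + μ * θ τ : ℂ) (y τ + ν * θ τ)
      rw [← h4, norm_mul, Complex.norm_real, Real.norm_eq_abs] at h5
      linarith
    have h4 : |y τ| ≤ K₁ * R + ‖μ‖ * |θ τ| := by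
      have h4 : (y τ : ℂ) = (y τ + μ * θ τ) - μ * θ τ := by ring
      have h5 := norm_sub_le (y τ + μ * θ τ : ℂ) (μ * θ τ)
      rw [← h4, norm_mul, Complex.norm_real, Complex.norm_real, Real.norm_eq_abs,
        Real.norm_eq_abs] at h5
      linarith
    have h5 := mul_le_mul_of_nonneg_left h3 (norm_nonneg μ)
    linarith
  · have hv : ∀ τ ≥ τ₁, |y τ + lam * θ τ| ≤ K₁ *
        (Real.exp (-lam * (τ - τ₀)) + ∫ s in τ₀..τ, Real.exp (-lam * (τ - s)) * |E s|) := by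
      intro τ hτ
      have := hv₁ τ hτ
      rw [hμ', ← Complex.ofReal_mul, ← Complex.ofReal_add, Complex.norm_real] at this
      exact this
    obtain ⟨K₃, hK₃, hθ₃⟩ := exists_decay_double (lam := lam) (w := fun τ => y τ + lam * θ τ) hτ₁
      (fun τ _ => (hθ τ).congr_deriv (by ring))
      (fun τ _ => ((hy τ).continuousAt.add
        (continuousAt_const.mul (hθ τ).continuousAt)).continuousWithinAt) hE hv
    refine ⟨(1 + lam) * K₃ + K₁, by positivity, τ₁, hτ₁, fun τ hτ => ?_⟩
    have h1 := hv τ hτ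
    have h2 := hθ₃ τ hτ
    have h0 : τ₀ ≤ τ := hτ₁.trans hτ
    simp only [hk]
    set J := (1 + (τ - τ₀)) * Real.exp (-lam * (τ - τ₀)) +
      ∫ s in τ₀..τ, ((1 + (τ - s)) * Real.exp (-lam * (τ - s))) * |E s|
    have hRJ : Real.exp (-lam * (τ - τ₀)) + (∫ s in τ₀..τ, Real.exp (-lam * (τ - s)) * |E s|)
        ≤ J := by
      have hEc : ContinuousOn (fun s => |E s|) (uIcc τ₀ τ) := by
        rw [uIcc_of_le h0]
        exact hE.abs.mono fun t ht => ht.1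
      refine add_le_add (exp_le_of_nonneg (by linarith)) (intervalIntegral.integral_mono_on h0
        (ContinuousOn.mul (by fun_prop) hEc).intervalIntegrable
        (ContinuousOn.mul (by fun_prop) hEc).intervalIntegrable fun s hs => ?_)
      exact mul_le_mul_of_nonneg_right (exp_le_of_nonneg (by linarith [hs.2])) (abs_nonneg _)
    have h3 : |y τ| ≤ |y τ + lam * θ τ| + lam * |θ τ| := by
      have := abs_sub (y τ + lam * θ τ) (lam * θ τ)
      rwa [add_sub_cancel_right, abs_mul, abs_of_pos hlam] at this
    have h4 := mul_le_mul_of_nonneg_left hRJ hK₁.le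
    have h5 := mul_le_mul_of_nonneg_left h2 hlam.le
    linarith

/-! ### The nonlinear perturbation and its size -/

/-- The deviation `f'(s) F(s) - q`. -/
noncomputable def errE (f : ℝ → ℝ) (q s : ℝ) : ℝ := deriv f s * F f s - q

/-- The deviation `F(s) f(s) / s - (q - 1)`. -/
noncomputable def errG (f : ℝ → ℝ) (q s : ℝ) : ℝ := F f s * f s / s - (q - 1)

/-- The perturbation of the linear equation `θ'' + a θ' + b θ = 0` satisfied by the relative
correction `θ` in logarithmic variables. -/
noncomputable def perturbation (f : ℝ → ℝ) (p q b s x y : ℝ) : ℝ :=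
  -4 * errG f q s * y - 4 * (F f s * f s / s) * errE f q s * (1 + x) -
    b * (F f s * f s / s) * (f (s * (1 + x)) / f s - 1 - p * x) - b * (p - 1) * errG f q s * x

namespace IsSuperlinear

variable {f : ℝ → ℝ} {p q : ℝ}

theorem tendsto_errE (h : IsSuperlinear f p q) : Tendsto (errE f q) atTop (𝓝 0) := by
  simpa using! h.tendsto_deriv_mul_F.sub_const q

theorem tendsto_errG (h : IsSuperlinear f p q) : Tendsto (errG f q) atTop (𝓝 0) := by
  simpa using! h.tendsto_F_mul_div.sub_const (q - 1)

theorem continuousOn_F (h : IsSuperlinear f p q) : ContinuousOn (F f) (Ioi 0) := fun _ hs =>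
  (h.hasDerivAt_F hs).continuousAt.continuousWithinAt

theorem continuousOn_errE (h : IsSuperlinear f p q) : ContinuousOn (errE f q) (Ioi 0) :=
  (h.continuousOn_deriv.mul h.continuousOn_F).sub continuousOn_const

theorem continuousOn_errG (h : IsSuperlinear f p q) : ContinuousOn (errG f q) (Ioi 0) :=
  ((h.continuousOn_F.mul h.continuousOn).div continuousOn_id fun _ hs => (ne_of_gt hs)).sub
    continuousOn_const

theorem monotoneOn (h : IsSuperlinear f p q) : MonotoneOn f (Ioi 0) :=
  (strictMonoOn_of_deriv_pos (convex_Ioi _) h.continuousOn fun s hs => by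
    rw [interior_Ioi] at hs
    exact h.deriv_pos s hs).monotoneOn

/-- Eventually f'/f ≤ (p+1)/u, so log f increases by at most p + 1 over [s, 2s]; to the left of s
monotonicity suffices. -/
theorem exists_doubling (h : IsSuperlinear f p q) :
    ∃ s₁ > 0, ∀ s ≥ s₁, ∀ t, 0 < t → t ≤ 2 * s → f t ≤ Real.exp (p + 1) * f s := by
  obtain ⟨s₁, hs₁⟩ := eventually_atTop.1
    ((h.tendsto_logDeriv.eventually (gt_mem_nhds (lt_add_one p))).and (eventually_gt_atTop 0))
  have hs0 : 0 < s₁ := (hs₁ s₁ le_rfl).2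
  have hp := h.p_pos
  refine ⟨s₁, hs0, fun s hs t ht hts => ?_⟩
  have hspos : 0 < s := hs0.trans_le hs
  have hfs := h.pos s hspos
  rcases le_or_gt t s with h' | h'
  · calc f t ≤ 1 * f s := by rw [one_mul]; exact h.monotoneOn ht hspos h'
      _ ≤ _ := mul_le_mul_of_nonneg_right (Real.one_le_exp (by linarith)) hfs.le
  · have h1 := le_of_deriv_le (c := -((p + 1) / s)) (τ₀ := s) (x := f) (x' := deriv f)
      (h := fun _ => 0) (fun u hu => h.hasDerivAt (hspos.trans_le hu)) (fun u hu => ?_)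
      continuousOn_const h'.le
    · simp only [mul_zero, intervalIntegral.integral_zero, add_zero, neg_neg] at h1
      refine h1.trans (mul_le_mul_of_nonneg_right (Real.exp_le_exp.2 ?_) hfs.le)
      rw [div_mul_eq_mul_div, div_le_iff₀ hspos]
      exact mul_le_mul_of_nonneg_left (by linarith) (by linarith)
    · have hu0 : 0 < u := hspos.trans_le hu
      have h2 := (hs₁ u (hs.trans hu)).1
      have hfu := h.pos u hu0
      rw [div_lt_iff₀ hfu] at h2
      have h3 : deriv f u ≤ (p + 1) * f u / u := by
        rw [le_div_iff₀ hu0]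
        linarith
      have h4 : (p + 1) * f u / u ≤ (p + 1) * f u / s := by gcongr
      have h5 : (p + 1) * f u / s = -(-((p + 1) / s)) * f u + 0 := by ring
      linarith

/-- Second order Taylor-type estimate for `f (s (1 + x)) / f s`. -/
theorem exists_taylor (h : IsSuperlinear f p q) :
    ∃ s₁ > 0, ∃ C > 0, ∀ s ≥ s₁, ∀ ρ ≤ 1 / 2, ∀ x x', |x| ≤ ρ → |x'| ≤ ρ →
      |(f (s * (1 + x)) / f s - p * x) - (f (s * (1 + x')) / f s - p * x')| ≤
        (C * ρ + |s * deriv f s / f s - p|) * |x - x'| := by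
  obtain ⟨s₁, hs₁, hdoub⟩ := h.exists_doubling
  set C₀ := p ^ 2 * (1 / q) + 1 with hC₀
  have hq := h.one_lt_q
  have hp := h.p_pos
  have hC₀0 : 0 < C₀ := by positivity
  have hlim := h.tendsto_sq_mul_deriv_deriv.abs
  rw [abs_of_nonneg (show 0 ≤ p ^ 2 * (1 / q) by positivity)] at hlim
  obtain ⟨s₂, hs₂⟩ := eventually_atTop.1 (hlim.eventually (gt_mem_nhds (lt_add_one _)))
  -- The points s(1+z) stay in [s/2, 2s], so s/2 must already exceed s₂. In the constant, 4 comes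
  -- from s ≤ 2ξ and the exponential from the doubling bound.
  refine ⟨max s₁ (2 * max s₂ 1), lt_max_of_lt_left hs₁, 4 * C₀ * Real.exp (p + 1), by positivity, ?_⟩
  intro s hs ρ hρ x x' hx hx'
  have hss₁ : s₁ ≤ s := (le_max_left _ _).trans hs
  have hss₂ : 2 * max s₂ 1 ≤ s := (le_max_right _ _).trans hs
  have hspos : 0 < s := hs₁.trans_le hss₁
  have hfs := h.pos s hspos
  set D := 4 * C₀ * Real.exp (p + 1) with hD
  have hsec : ∀ ξ ∈ Icc (s / 2) (2 * s), |deriv (deriv f) ξ| ≤ D * f s / s ^ 2 := by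
    intro ξ hξ
    have hξ0 : 0 < ξ := lt_of_lt_of_le (by positivity) hξ.1
    have h1 : s₂ ≤ ξ := by linarith [le_max_left s₂ 1, hξ.1]
    have h2 := (hs₂ ξ h1).le
    have hfξ := h.pos ξ hξ0
    rw [abs_div, abs_mul, abs_of_pos (pow_pos hξ0 2), abs_of_pos hfξ, div_le_iff₀ hfξ] at h2
    have h3 := hdoub s hss₁ ξ hξ0 hξ.2
    rw [le_div_iff₀ (pow_pos hspos 2)]
    have h4 : s ^ 2 ≤ 4 * ξ ^ 2 := by nlinarith [hξ.1]
    calc |deriv (deriv f) ξ| * s ^ 2 ≤ |deriv (deriv f) ξ| * (4 * ξ ^ 2) := by gcongr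
      _ = 4 * (ξ ^ 2 * |deriv (deriv f) ξ|) := by ring
      _ ≤ 4 * (C₀ * f ξ) := by gcongr
      _ ≤ 4 * (C₀ * (Real.exp (p + 1) * f s)) := by gcongr
      _ = D * f s := by rw [hD]; ring
  have hmem : ∀ z, |z| ≤ ρ → s * (1 + z) ∈ Icc (s / 2) (2 * s) := by
    intro z hz
    have := abs_le.1 (hz.trans hρ)
    constructor <;> nlinarith [this.1, this.2]
  have hfirst : ∀ z, |z| ≤ ρ → |deriv f (s * (1 + z)) - deriv f s| ≤ D * f s / s ^ 2 * (s * |z|) := by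
    intro z hz
    have := (convex_Icc (s / 2) (2 * s)).norm_image_sub_le_of_norm_hasDerivWithin_le
      (f := deriv f) (f' := deriv (deriv f)) (C := D * f s / s ^ 2)
      (fun ξ hξ => (h.hasDerivAt_deriv (lt_of_lt_of_le (by positivity) hξ.1)).hasDerivWithinAt)
      hsec (show s ∈ Icc (s / 2) (2 * s) from ⟨by linarith, by linarith⟩) (hmem z hz)
    rwa [Real.norm_eq_abs, Real.norm_eq_abs, show s * (1 + z) - s = s * z by ring, abs_mul,
      abs_of_pos hspos] at this
  have hder : ∀ z ∈ Icc (-ρ) ρ, HasDerivWithinAt (fun z => f (s * (1 + z)) / f s - p * z)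
      (s * deriv f (s * (1 + z)) / f s - p) (Icc (-ρ) ρ) z := by
    intro z hz
    have hz' := hmem z (abs_le.2 hz)
    have h0 : 0 < s * (1 + z) := lt_of_lt_of_le (by positivity) hz'.1
    have h1 : HasDerivAt (fun z => s * (1 + z)) s z := by
      simpa using ((hasDerivAt_id' z).const_add 1).const_mul s
    have h2 := (((h.hasDerivAt h0).comp z h1).div_const (f s)).fun_sub
      ((hasDerivAt_id' z).const_mul p)
    refine (h2.congr_deriv ?_).hasDerivWithinAt
    ring
  have hbd : ∀ z ∈ Icc (-ρ) ρ, ‖s * deriv f (s * (1 + z)) / f s - p‖ ≤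
      D * ρ + |s * deriv f s / f s - p| := by
    intro z hz
    have h1 := hfirst z (abs_le.2 hz)
    have h2 : s * deriv f (s * (1 + z)) / f s - p =
        s / f s * (deriv f (s * (1 + z)) - deriv f s) + (s * deriv f s / f s - p) := by ring
    rw [Real.norm_eq_abs, h2]
    refine (abs_add_le _ _).trans (add_le_add ?_ le_rfl)
    rw [abs_mul, abs_of_pos (div_pos hspos hfs)]
    calc s / f s * |deriv f (s * (1 + z)) - deriv f s|
        ≤ s / f s * (D * f s / s ^ 2 * (s * |z|)) := by gcongr
      _ = D * |z| := by field_simp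
      _ ≤ D * ρ := by
        have := abs_le.2 hz
        gcongr
  have := (convex_Icc (-ρ) ρ).norm_image_sub_le_of_norm_hasDerivWithin_le hder hbd
    (abs_le.1 hx') (abs_le.1 hx)
  simpa only [Real.norm_eq_abs] using this

set_option maxHeartbeats 800000 in
/-- The perturbation is Lipschitz with a small constant and quadratically small up to the
deviations. -/
theorem exists_perturbation_bounds (h : IsSuperlinear f p q) {b : ℝ} (hb : 0 < b) :
    ∃ s₁ > 0, ∃ C > 0, ∀ s ≥ s₁,
      (∀ δ ≤ 1 / 2, ∀ x x' y y', |x| ≤ δ → |x'| ≤ δ → |y| ≤ δ → |y'| ≤ δ →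
        |perturbation f p q b s x y - perturbation f p q b s x' y'| ≤
          C * (δ + |errE f q s| + |errG f q s|) * (|x - x'| + |y - y'|)) ∧
      |perturbation f p q b s 0 0| ≤ C * |errE f q s| ∧
      (∀ x y, |x| ≤ 1 / 2 → |y| ≤ 1 / 2 → |perturbation f p q b s x y| ≤
        C * (|errE f q s| + |errG f q s| + (|x| + |y|) ^ 2)) := by
  have hq := h.one_lt_q
  have hp := h.one_lt
  set k := q - 1 with hk
  have hk0 : 0 < k := by linarith
  obtain ⟨s₁, hs₁, C, hC, htay⟩ := h.exists_taylor
  obtain ⟨s₂, hs₂⟩ := eventually_atTop.1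
    (((h.tendsto_F_mul_div.eventually (lt_mem_nhds (show k / 2 < q - 1 by linarith))).and
    (h.tendsto_F_mul_div.eventually (gt_mem_nhds (show q - 1 < 2 * k by linarith)))))
  set A := 2 * (1 + p) / k with hA
  have hA0 : 0 < A := by positivity
  set C₅ := 4 + 8 * k + b * (2 * k) * (C + A) + b * (p - 1) with hC₅
  have hb1 : 0 < b * (2 * k) * (C + A) := by positivity
  have hb2 : 0 < b * (p - 1) := mul_pos hb (by linarith)
  have hC₅0 : 0 < C₅ := by positivity
  refine ⟨max s₁ s₂, lt_max_of_lt_left hs₁, 3 * C₅, by positivity, fun s hs => ?_⟩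
  have hss₁ : s₁ ≤ s := (le_max_left _ _).trans hs
  have hspos : 0 < s := hs₁.trans_le hss₁
  have hfs := h.pos s hspos
  have hFs := h.F_pos hspos
  obtain ⟨hg1, hg2⟩ := hs₂ s ((le_max_right _ _).trans hs)
  have hG : errG f q s = F f s * f s / s - k := rfl
  -- Since p + q = pq, multiplying s f'/f - p by F f/s gives exactly E - pG, and F f/s is at least
  -- k/2 here.
  have hφ : |s * deriv f s / f s - p| ≤ A * (|errE f q s| + |errG f q s|) := by
    have h1 : (s * deriv f s / f s - p) * (F f s * f s / s) = errE f q s - p * errG f q s := by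
      rw [errE, errG]
      have := h.conj_mul
      field_simp
      linear_combination s * this
    have h2 : |s * deriv f s / f s - p| * (k / 2) ≤ |errE f q s| + p * |errG f q s| := by
      have h3 := congrArg abs h1
      rw [abs_mul, abs_of_pos (show 0 < F f s * f s / s by positivity)] at h3
      have h4 := abs_sub (errE f q s) (p * errG f q s)
      rw [abs_mul p, abs_of_pos h.p_pos] at h4
      have h5 : |s * deriv f s / f s - p| * (k / 2) ≤
          |s * deriv f s / f s - p| * (F f s * f s / s) := by gcongr
      linarith
    have h3 : A * (|errE f q s| + |errG f q s|) * (k / 2) =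
        (1 + p) * (|errE f q s| + |errG f q s|) := by rw [hA]; field_simp
    have h4 : |errE f q s| + p * |errG f q s| ≤ (1 + p) * (|errE f q s| + |errG f q s|) := by
      nlinarith [abs_nonneg (errE f q s), abs_nonneg (errG f q s)]
    exact le_of_mul_le_mul_right (h2.trans (h4.trans h3.ge)) (by positivity)
  set g := F f s * f s / s with hg
  have hg0 : 0 < g := by positivity
  have hE0 := abs_nonneg (errE f q s)
  have hG0 := abs_nonneg (errG f q s)
  have lip : ∀ δ ≤ 1 / 2, ∀ x x' y y', |x| ≤ δ → |x'| ≤ δ → |y| ≤ δ → |y'| ≤ δ →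
      |perturbation f p q b s x y - perturbation f p q b s x' y'| ≤
        C₅ * (δ + |errE f q s| + |errG f q s|) * (|x - x'| + |y - y'|) := by
    intro δ hδ x x' y y' hx hx' hy hy'
    have hδ0 : 0 ≤ δ := (abs_nonneg _).trans hx
    have h1 := htay s hss₁ δ hδ x x' hx hx'
    set T := (f (s * (1 + x)) / f s - p * x) - (f (s * (1 + x')) / f s - p * x') with hT
    set S := δ + |errE f q s| + |errG f q s| with hS
    have hST : |T| ≤ (C + A) * S * |x - x'| := by
      refine h1.trans (mul_le_mul_of_nonneg_right ?_ (abs_nonneg _))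
      have h2 : C * δ ≤ C * S := by gcongr; linarith
      have h3 : A * (|errE f q s| + |errG f q s|) ≤ A * S := by gcongr; linarith
      linarith
    have hdecomp : perturbation f p q b s x y - perturbation f p q b s x' y' =
        -(4 * errG f q s * (y - y')) - 4 * g * errE f q s * (x - x') - b * g * T -
          b * (p - 1) * errG f q s * (x - x') := by
      simp only [perturbation, hT, ← hg]
      ring
    rw [hdecomp]
    have hX := abs_nonneg (x - x')
    have hY := abs_nonneg (y - y')
    have t1 : |-(4 * errG f q s * (y - y'))| ≤ 4 * S * |y - y'| := by
      rw [abs_neg, abs_mul, abs_mul, abs_of_pos (show (0 : ℝ) < 4 by norm_num)]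
      gcongr
      linarith
    have t2 : |4 * g * errE f q s * (x - x')| ≤ 8 * k * S * |x - x'| := by
      rw [abs_mul, abs_mul, abs_of_pos (show 0 < 4 * g by positivity)]
      have : 4 * g ≤ 8 * k := by linarith
      gcongr
      linarith
    have t3 : |b * g * T| ≤ b * (2 * k) * (C + A) * S * |x - x'| := by
      rw [abs_mul, abs_of_pos (show 0 < b * g by positivity)]
      calc b * g * |T| ≤ b * (2 * k) * ((C + A) * S * |x - x'|) := by gcongr
        _ = _ := by ring
    have t4 : |b * (p - 1) * errG f q s * (x - x')| ≤ b * (p - 1) * S * |x - x'| := by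
      rw [abs_mul, abs_mul, abs_of_pos hb2]
      gcongr
      linarith
    have hS0 : 0 ≤ S := by positivity
    have key := abs_sub (-(4 * errG f q s * (y - y')) - 4 * g * errE f q s * (x - x') - b * g * T)
      (b * (p - 1) * errG f q s * (x - x'))
    have key2 := abs_sub (-(4 * errG f q s * (y - y')) - 4 * g * errE f q s * (x - x')) (b * g * T)
    have key3 := abs_sub (-(4 * errG f q s * (y - y'))) (4 * g * errE f q s * (x - x'))
    have e1 : 0 ≤ (8 * k + b * (2 * k) * (C + A) + b * (p - 1)) * S * |y - y'| := by positivity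
    have e2 : 0 ≤ 4 * S * |x - x'| := by positivity
    have e3 : C₅ * S * (|x - x'| + |y - y'|) =
        4 * S * |y - y'| + 8 * k * S * |x - x'| + b * (2 * k) * (C + A) * S * |x - x'| +
        b * (p - 1) * S * |x - x'| +
        (8 * k + b * (2 * k) * (C + A) + b * (p - 1)) * S * |y - y'| + 4 * S * |x - x'| := by
      rw [hC₅]
      ring
    linarith
  have zero : |perturbation f p q b s 0 0| ≤ C₅ * |errE f q s| := by
    have h1 : perturbation f p q b s 0 0 = -(4 * g * errE f q s) := by
      simp only [perturbation, ← hg]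
      simp [hfs.ne']
    rw [h1, abs_neg, abs_mul, abs_of_pos (show 0 < 4 * g by positivity)]
    gcongr
    linarith
  refine ⟨fun δ hδ x x' y y' hx hx' hy hy' => ?_, ?_, fun x y hx hy => ?_⟩
  · refine (lip δ hδ x x' y y' hx hx' hy hy').trans ?_
    have hδ0 : 0 ≤ δ := (abs_nonneg _).trans hx
    gcongr
    linarith
  · refine zero.trans ?_
    gcongr
    linarith
  · have h1 := lip (max |x| |y|) (max_le hx hy) x 0 y 0 (le_max_left _ _) (by simp)
      (le_max_right _ _) (by simp)
    rw [sub_zero, sub_zero] at h1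
    have h2 := abs_sub_abs_le_abs_sub (perturbation f p q b s x y) (perturbation f p q b s 0 0)
    have hx0 := abs_nonneg x
    have hy0 := abs_nonneg y
    have h3 : max |x| |y| ≤ |x| + |y| := max_le (by linarith) (by linarith)
    -- Because |x| + |y| ≤ 1, the factor |x| + |y| can be dropped from the E and G terms.
    have h4 : C₅ * (max |x| |y| + |errE f q s| + |errG f q s|) * (|x| + |y|) ≤
        C₅ * ((|x| + |y|) ^ 2 + |errE f q s| + |errG f q s|) := by
      rw [mul_assoc]
      refine mul_le_mul_of_nonneg_left ?_ hC₅0.le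
      nlinarith
    have h5 : 0 ≤ C₅ * (|errE f q s| + |errG f q s| + (|x| + |y|) ^ 2) := by positivity
    have h6 : 0 ≤ C₅ * (|errG f q s| + (|x| + |y|) ^ 2) := by positivity
    linarith

end IsSuperlinear

/-! ### The profile and its correction in logarithmic variables -/

/-- The approximate singular solution in the variable `τ = -log r`. -/
noncomputable def logProfile (N : ℕ) (f : ℝ → ℝ) (q τ : ℝ) : ℝ := uTilde N f q (Real.exp (-τ))

namespace IsSuperlinear

variable {f : ℝ → ℝ} {p q : ℝ}

/-- As soon as e^{-2τ}/b drops below F(1) it lies in the range of F, where `FInv` is a true inverse;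
the derivative then follows from (F⁻¹)' = -f∘F⁻¹. -/
theorem eventually_logProfile (h : IsSuperlinear f p q) {N : ℕ} (hb : 0 < coeffB N q) :
    ∀ᶠ τ in atTop, 0 < logProfile N f q τ ∧
      F f (logProfile N f q τ) = Real.exp (-τ) ^ 2 / coeffB N q ∧
      HasDerivAt (logProfile N f q)
        (2 * F f (logProfile N f q τ) * f (logProfile N f q τ)) τ := by
  have hlim : Tendsto (fun τ : ℝ => Real.exp (-τ) ^ 2 / coeffB N q) atTop (𝓝 0) := by
    have := ((Real.tendsto_exp_atBot.comp tendsto_neg_atTop_atBot).pow 2).div_const (coeffB N q)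
    simpa using! this
  filter_upwards [hlim.eventually (gt_mem_nhds (h.F_pos one_pos))] with τ hτ
  obtain ⟨t, ht, hFt⟩ := h.mem_image_F one_pos
    (show 0 < Real.exp (-τ) ^ 2 / coeffB N q by positivity) hτ.le
  have hU : logProfile N f q τ = t := by
    rw [logProfile, uTilde, show 2 * (N : ℝ) - 4 * q = coeffB N q from rfl, ← hFt]
    exact h.FInv_F ht
  rw [hU]
  refine ⟨ht, hFt, ?_⟩
  have h1 : HasDerivAt (fun τ : ℝ => Real.exp (-τ) ^ 2 / coeffB N q)
      (-2 * (Real.exp (-τ) ^ 2 / coeffB N q)) τ := by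
    refine (((hasDerivAt_neg τ).exp.fun_pow 2).div_const (coeffB N q)).congr_deriv ?_
    push_cast
    ring
  have h2 := h.hasDerivAt_FInv ht
  rw [hFt] at h2
  have h3 := HasDerivAt.comp (h₂ := FInv f)
    (h := fun τ : ℝ => Real.exp (-τ) ^ 2 / coeffB N q) τ h2 h1
  refine (show HasDerivAt (logProfile N f q) _ τ from h3).congr_deriv ?_
  rw [hFt]
  ring

theorem tendsto_logProfile (h : IsSuperlinear f p q) {N : ℕ} (hb : 0 < coeffB N q) :
    Tendsto (logProfile N f q) atTop atTop := by
  have hlim : Tendsto (fun τ : ℝ => Real.exp (-τ) ^ 2 / coeffB N q) atTop (𝓝 0) := by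
    have := ((Real.tendsto_exp_atBot.comp tendsto_neg_atTop_atBot).pow 2).div_const (coeffB N q)
    simpa using! this
  rw [tendsto_atTop]
  intro S
  have hS : 0 < max S 1 := lt_max_of_lt_right one_pos
  filter_upwards [h.eventually_logProfile hb, hlim.eventually (gt_mem_nhds (h.F_pos hS))]
    with τ h1 h2
  rw [← h1.2.1] at h2
  exact (le_max_left S 1).trans ((h.strictAntiOn_F.lt_iff_gt h1.1 hS).1 h2).le

/-- The second deviation relaxes along the profile at a rate tending to 2(q-1), driven by the first
one. This is why only f'F - q appears in the final estimate. -/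
theorem hasDerivAt_errG (h : IsSuperlinear f p q) {U : ℝ → ℝ} {τ : ℝ} (hU : 0 < U τ)
    (hd : HasDerivAt U (2 * F f (U τ) * f (U τ)) τ) :
    HasDerivAt (fun τ => errG f q (U τ)) (2 * (F f (U τ) * f (U τ) / U τ) *
      (errE f q (U τ) - errG f q (U τ))) τ := by
  have hf := (h.pos _ hU).ne'
  have h1 := ((((h.hasDerivAt_F hU).fun_mul (h.hasDerivAt hU)).fun_div (hasDerivAt_id' (U τ))
    hU.ne').sub_const (q - 1)).comp τ hd
  refine (show HasDerivAt (fun τ => errG f q (U τ)) _ τ from h1).congr_deriv ?_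
  rw [errE, errG]
  field_simp
  ring

theorem continuousOn_perturbation (h : IsSuperlinear f p q) (b : ℝ) {s : Set ℝ} {U x y : ℝ → ℝ}
    (hU : ContinuousOn U s) (hU0 : ∀ τ ∈ s, 0 < U τ) (hx : Continuous x) (hy : Continuous y)
    (hx0 : ∀ τ, |x τ| ≤ 1 / 2) :
    ContinuousOn (fun τ => perturbation f p q b (U τ) (x τ) (y τ)) s := by
  have hE : ContinuousOn (fun τ => errE f q (U τ)) s := h.continuousOn_errE.comp hU hU0
  have hG : ContinuousOn (fun τ => errG f q (U τ)) s := h.continuousOn_errG.comp hU hU0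
  have hF : ContinuousOn (fun τ => F f (U τ)) s := h.continuousOn_F.comp hU hU0
  have hf : ContinuousOn (fun τ => f (U τ)) s := h.continuousOn.comp hU hU0
  have hg : ContinuousOn (fun τ => F f (U τ) * f (U τ) / U τ) s :=
    (hF.mul hf).div hU fun τ hτ => (hU0 τ hτ).ne'
  have hf1 : ContinuousOn (fun τ => f (U τ * (1 + x τ))) s := by
    refine h.continuousOn.comp (hU.mul (by fun_prop)) fun τ hτ => ?_
    have h1 := (abs_le.1 (hx0 τ)).1
    exact mul_pos (hU0 τ hτ) (by linarith)
  have hH : ContinuousOn (fun τ => f (U τ * (1 + x τ)) / f (U τ)) s :=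
    hf1.div hf fun τ hτ => (h.pos _ (hU0 τ hτ)).ne'
  unfold perturbation
  fun_prop

/-- Existence of the relative correction in logarithmic variables. -/
theorem exists_log_correction (h : IsSuperlinear f p q) {N : ℕ} {a : ℝ} (ha : 0 < a)
    (hb : 0 < coeffB N q) (haq : a / 2 < 2 * (q - 1)) :
    ∃ τ₀ : ℝ, ∃ ε > 0,
      (∀ τ ≥ τ₀ - 1, 0 < logProfile N f q τ ∧
        F f (logProfile N f q τ) = Real.exp (-τ) ^ 2 / coeffB N q ∧
        HasDerivAt (logProfile N f q)
          (2 * F f (logProfile N f q τ) * f (logProfile N f q τ)) τ) ∧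
      ∀ α β : ℝ, |α| + |β| < ε → ∃ θ y n : ℝ → ℝ, Continuous n ∧ θ τ₀ = α ∧ y τ₀ = β ∧
        (∀ τ, HasDerivAt θ (y τ) τ) ∧
        (∀ τ, HasDerivAt y (-a * y τ - coeffB N q * θ τ + n τ) τ) ∧
        (∀ τ ≥ τ₀, n τ = perturbation f p q (coeffB N q) (logProfile N f q τ) (θ τ) (y τ) ∧
          |θ τ| ≤ 1 / 2) ∧
        Tendsto (fun τ => |θ τ| + |y τ|) atTop (𝓝 0) ∧
        ∃ K > 0, ∃ τ₁ ≥ τ₀, ∀ τ ≥ τ₁, |θ τ| + |y τ| ≤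
          K * (decayKernel a (coeffB N q) (τ - τ₀) +
            ∫ s in τ₀..τ, decayKernel a (coeffB N q) (τ - s) *
              |errE f q (logProfile N f q s)|) := by
  set b := coeffB N q with hbdef
  set U := logProfile N f q with hUdef
  have hq : 0 < q - 1 := by linarith [h.one_lt_q]
  -- κ₀ must exceed the linear decay rate, which is at most a/2, and stay below the relaxation rate
  -- 2(q-1) so that the term -2G² can be absorbed.
  obtain ⟨κ₀, hκ₁, hκ₂⟩ := exists_between haq
  obtain ⟨s₁, hs₁, Cp, hCp, hpert⟩ := h.exists_perturbation_bounds hb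
  obtain ⟨C, hC, δ₀, hδ₀, hsol⟩ := exists_decaying_solution ha hb hκ₁
    (show 0 < Cp + 4 * (q - 1) by positivity)
  -- The third bound on δ makes C times the Lipschitz constant 3·Cp·δ at most 1/8. Below, e bounds E
  -- so that C·Cp·e ≤ δ/4, and γ bounds G so that 2G² ≤ (2(q-1) - κ₀)|G|.
  set δ := min δ₀ (min (1 / 2) (1 / (24 * C * Cp))) with hδ
  have hδpos : 0 < δ := by positivity
  have hδ1 : δ ≤ δ₀ := min_le_left _ _
  have hδ2 : δ ≤ 1 / 2 := (min_le_right _ _).trans (min_le_left _ _)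
  have hδ3 : δ ≤ 1 / (24 * C * Cp) := (min_le_right _ _).trans (min_le_right _ _)
  set e := min δ (δ / (4 * C * Cp)) with he
  have hepos : 0 < e := by positivity
  set γ := min δ (min (q - 1) ((2 * (q - 1) - κ₀) / 2)) with hγ
  have hγpos : 0 < γ := lt_min hδpos (lt_min hq (by linarith))
  have hUtop := h.tendsto_logProfile hb
  have hE0 : Tendsto (fun τ => errE f q (U τ)) atTop (𝓝 0) := h.tendsto_errE.comp hUtop
  have hG0 : Tendsto (fun τ => errG f q (U τ)) atTop (𝓝 0) := h.tendsto_errG.comp hUtop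
  have hE0' := hE0.abs
  have hG0' := hG0.abs
  rw [abs_zero] at hE0' hG0'
  obtain ⟨τ₂, hτ₂⟩ := eventually_atTop.1 ((h.eventually_logProfile hb).and
    ((hUtop.eventually_ge_atTop s₁).and ((hE0'.eventually (gt_mem_nhds hepos)).and
      (hG0'.eventually (gt_mem_nhds hγpos)))))
  refine ⟨τ₂ + 1, δ / (4 * C), by positivity, fun τ hτ => (hτ₂ τ (by linarith)).1, ?_⟩
  intro α β hαβ
  set τ₀ := τ₂ + 1
  have hprof : ∀ τ ≥ τ₀, 0 < U τ ∧ F f (U τ) = Real.exp (-τ) ^ 2 / b ∧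
      HasDerivAt U (2 * F f (U τ) * f (U τ)) τ := fun τ hτ =>
    (hτ₂ τ ((le_add_of_nonneg_right zero_le_one).trans hτ)).1
  have hsmall : ∀ τ ≥ τ₀, s₁ ≤ U τ ∧ |errE f q (U τ)| < e ∧ |errG f q (U τ)| < γ := fun τ hτ =>
    (hτ₂ τ ((le_add_of_nonneg_right zero_le_one).trans hτ)).2
  have hUc : ContinuousOn U (Ici τ₀) := fun τ hτ =>
    (hprof τ hτ).2.2.continuousAt.continuousWithinAt
  have hU0 : ∀ τ ∈ Ici τ₀, 0 < U τ := fun τ hτ => (hprof τ hτ).1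
  have hEc : ContinuousOn (fun τ => errE f q (U τ)) (Ici τ₀) := h.continuousOn_errE.comp hUc hU0
  have hGc : ContinuousOn (fun τ => errG f q (U τ)) (Ici τ₀) := h.continuousOn_errG.comp hUc hU0
  have hGd : ∀ τ ≥ τ₀, HasDerivAt (fun τ => errG f q (U τ)) (-(2 * (q - 1)) * errG f q (U τ) +
      (-2 * errG f q (U τ) * errG f q (U τ) +
        2 * (errG f q (U τ) + (q - 1)) * errE f q (U τ))) τ := fun τ hτ => by
    refine (h.hasDerivAt_errG (hprof τ hτ).1 (hprof τ hτ).2.2).congr_deriv ?_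
    have : F f (U τ) * f (U τ) / U τ = errG f q (U τ) + (q - 1) := by rw [errG]; ring
    rw [this]
    ring
  obtain ⟨m, -, hm⟩ := exists_majorant_real hGd (by fun_prop)
  have hm0 : ∀ τ ≥ τ₀, 0 ≤ m τ := fun τ hτ => (abs_nonneg _).trans (hm τ hτ).2
  have hlip : ∀ τ ≥ τ₀, ∀ x x' y y', |x| ≤ δ → |x'| ≤ δ → |y| ≤ δ → |y'| ≤ δ →
      |perturbation f p q b (U τ) x y - perturbation f p q b (U τ) x' y'| ≤
        3 * Cp * δ * (|x - x'| + |y - y'|) := by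
    intro τ hτ x x' y y' hx hx' hy hy'
    obtain ⟨h1, h2, h3⟩ := hsmall τ hτ
    refine ((hpert _ h1).1 δ hδ2 x x' y y' hx hx' hy hy').trans ?_
    refine mul_le_mul_of_nonneg_right ?_ (by positivity)
    have h4 : e ≤ δ := min_le_left _ _
    have h5 : γ ≤ δ := min_le_left _ _
    calc Cp * (δ + |errE f q (U τ)| + |errG f q (U τ)|) ≤ Cp * (δ + δ + δ) := by
          gcongr <;> linarith
      _ = 3 * Cp * δ := by ring
  have hzero : ∀ τ ≥ τ₀, |perturbation f p q b (U τ) 0 0| ≤ Cp * e := by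
    intro τ hτ
    obtain ⟨h1, h2, -⟩ := hsmall τ hτ
    exact (hpert _ h1).2.1.trans (by gcongr)
  have hCκ : C * (3 * Cp * δ) ≤ 1 / 8 := by
    rw [le_div_iff₀ (by positivity)] at hδ3
    linarith
  have hCη : C * (Cp * e) ≤ δ / 4 := by
    have h4 : e ≤ δ / (4 * C * Cp) := min_le_right _ _
    rw [le_div_iff₀ (by positivity)] at h4
    linarith
  have hCD : C * (|α| + |β|) ≤ δ / 4 := by
    rw [lt_div_iff₀ (by positivity)] at hαβ
    linarith
  have hm' : ∀ τ ≥ τ₀, -(2 * (q - 1)) * m τ + |-2 * errG f q (U τ) * errG f q (U τ) +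
      2 * (errG f q (U τ) + (q - 1)) * errE f q (U τ)| ≤
        -κ₀ * m τ + (Cp + 4 * (q - 1)) * |errE f q (U τ)| := by
    intro τ hτ
    obtain ⟨-, -, h3⟩ := hsmall τ hτ
    have h4 : γ ≤ q - 1 := (min_le_right _ _).trans (min_le_left _ _)
    have h5 : γ ≤ (2 * (q - 1) - κ₀) / 2 := (min_le_right _ _).trans (min_le_right _ _)
    have h6 := (hm τ hτ).2
    set G := errG f q (U τ)
    set E := errE f q (U τ)
    have h7 : |-2 * G * G + 2 * (G + (q - 1)) * E| ≤ 2 * |G| * |G| + 2 * (|G| + (q - 1)) * |E| := by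
      refine (abs_add_le _ _).trans (add_le_add ?_ ?_)
      · rw [abs_mul, abs_mul]
        norm_num
      · rw [abs_mul, abs_mul, abs_of_pos (show (0 : ℝ) < 2 by norm_num)]
        gcongr
        refine (abs_add_le _ _).trans ?_
        rw [abs_of_pos hq]
    have h8 : 2 * |G| * |G| ≤ (2 * (q - 1) - κ₀) * m τ := by
      refine mul_le_mul ?_ h6 (abs_nonneg _) (by linarith)
      linarith
    have h9 : 2 * (|G| + (q - 1)) * |E| ≤ (4 * (q - 1)) * |E| := by
      refine mul_le_mul_of_nonneg_right ?_ (abs_nonneg _)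
      linarith
    have h10 : 0 ≤ Cp * |E| := by positivity
    linarith
  have hNl : ∀ τ ≥ τ₀, ∀ x y, |x| ≤ δ → |y| ≤ δ → |perturbation f p q b (U τ) x y| ≤
      (Cp + 4 * (q - 1)) * (|errE f q (U τ)| + m τ + (|x| + |y|) ^ 2) := by
    intro τ hτ x y hx hy
    obtain ⟨h1, -, -⟩ := hsmall τ hτ
    have h6 := (hm τ hτ).2
    refine ((hpert _ h1).2.2 x y (hx.trans hδ2) (hy.trans hδ2)).trans ?_
    have := hm0 τ hτ
    gcongr
    linarith
  obtain ⟨θ, y, n, hn, hα, hβ, hθ, hy, hall, hlim, hdec⟩ := hsol τ₀ δ (3 * Cp * δ) (Cp * e) α β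
    (fun τ x y => perturbation f p q b (U τ) x y) (fun τ => errE f q (U τ)) m _ hδpos hδ1
    (by positivity) (fun x y hx hy hx' _ => h.continuousOn_perturbation b hUc hU0 hx hy
      fun τ => (hx' τ).trans hδ2) hlip hzero hCκ hCη hCD hEc hE0 (fun τ hτ => (hm τ hτ).1) hm0 hm'
    hNl
  exact ⟨θ, y, n, hn, hα, hβ, hθ, hy,
    fun τ hτ => ⟨(hall τ hτ).1, (hall τ hτ).2.1.trans hδ2⟩, hlim, hdec⟩

/-- The corrected profile solves the Emden–Fowler form of the radial equation. -/
theorem hasDerivAt_corrected (h : IsSuperlinear f p q) {N : ℕ} (hb : 0 < coeffB N q)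
    {U θ y n : ℝ → ℝ} {τ : ℝ} (hU : 0 < U τ) (hFU : F f (U τ) = Real.exp (-τ) ^ 2 / coeffB N q)
    (hd : HasDerivAt U (2 * F f (U τ) * f (U τ)) τ) (hθ : HasDerivAt θ (y τ) τ)
    (hy : HasDerivAt y (-(4 * q - N - 2) * y τ - coeffB N q * θ τ + n τ) τ)
    (hn : n τ = perturbation f p q (coeffB N q) (U τ) (θ τ) (y τ)) :
    HasDerivAt (fun t => U t * (1 + θ t)) (2 * F f (U τ) * f (U τ) * (1 + θ τ) + U τ * y τ) τ ∧
    ∃ w, HasDerivAt (fun t => 2 * F f (U t) * f (U t) * (1 + θ t) + U t * y t) w τ ∧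
      w - (N - 2) * (2 * F f (U τ) * f (U τ) * (1 + θ τ) + U τ * y τ) +
        Real.exp (-τ) ^ 2 * f (U τ * (1 + θ τ)) = 0 := by
  refine ⟨hd.fun_mul (hθ.const_add 1), _, ((((((h.hasDerivAt_F hU).comp τ hd).const_mul 2).fun_mul
    ((h.hasDerivAt hU).comp τ hd)).fun_mul (hθ.const_add 1)).fun_add (hd.fun_mul hy)), ?_⟩
  -- Replacing e^{-2τ} by bF(U) removes the explicit τ; what remains is an algebraic identity using
  -- b = 2N - 4q and p + q = pq.
  have hexp : Real.exp (-τ) ^ 2 = coeffB N q * F f (U τ) := by rw [hFU]; field_simp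
  have hf := (h.pos _ hU).ne'
  have hbd : coeffB N q = 2 * N - 4 * q := rfl
  have hc := h.conj_mul
  rw [hexp, hn, perturbation, errE, errG]
  simp only [Function.comp_apply]
  field_simp
  rw [hbd]
  linear_combination (θ τ * U τ * (4 * q - 2 * N)) * hc

end IsSuperlinear

/-! ### The Laplacian of a radial function in logarithmic variables -/

section Radial

variable {E : Type*} [NormedAddCommGroup E] [InnerProductSpace ℝ E]

theorem hasFDerivAt_neg_log_norm {x : E} (hx : x ≠ 0) :
    HasFDerivAt (fun y : E => -Real.log ‖y‖) (-(‖x‖ ^ 2)⁻¹ • innerSL ℝ x) x := by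
  have h0 : ‖x‖ ^ 2 ≠ 0 := by simpa using hx
  have h1 := (((hasStrictFDerivAt_norm_sq x).hasFDerivAt.log h0).const_smul (-(1 / 2) : ℝ))
  have h2 : (fun y : E => -Real.log ‖y‖) = fun y => (-(1 / 2) : ℝ) • Real.log (‖y‖ ^ 2) := by
    funext y
    rw [Real.log_pow]
    simp
  rw [h2]
  refine h1.congr_fderiv ?_
  ext z
  simp
  ring

/-- The Laplacian of a function of `-log ‖x‖`. -/
theorem laplacian_comp_neg_log_norm [FiniteDimensional ℝ E] {v v₁ : ℝ → ℝ} {w : ℝ} {x : E}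
    (hx : x ≠ 0) (hv : ∀ᶠ t in 𝓝 (-Real.log ‖x‖), HasDerivAt v (v₁ t) t)
    (hv₁ : HasDerivAt v₁ w (-Real.log ‖x‖)) :
    Laplacian.laplacian (fun y : E => v (-Real.log ‖y‖)) x =
      (w - (Module.finrank ℝ E - 2) * v₁ (-Real.log ‖x‖)) / ‖x‖ ^ 2 := by
  have hxn : ‖x‖ ^ 2 ≠ 0 := by simpa using hx
  have hL := hasFDerivAt_neg_log_norm hx
  have hfd : fderiv ℝ (fun y : E => v (-Real.log ‖y‖)) =ᶠ[𝓝 x]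
      fun y => (-(v₁ (-Real.log ‖y‖)) * (‖y‖ ^ 2)⁻¹) • innerSL ℝ y := by
    filter_upwards [hL.continuousAt.eventually hv, isOpen_ne.mem_nhds hx] with y hy hy0
    rw [(show HasFDerivAt (fun y : E => v (-Real.log ‖y‖)) _ y from
      hy.comp_hasFDerivAt y (hasFDerivAt_neg_log_norm hy0)).fderiv, smul_smul]
    congr 1
    ring
  have hk : HasFDerivAt (fun y : E => -(v₁ (-Real.log ‖y‖)) * (‖y‖ ^ 2)⁻¹)
      (((w + 2 * v₁ (-Real.log ‖x‖)) * ((‖x‖ ^ 2)⁻¹) ^ 2) • innerSL ℝ x) x := by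
    refine ((hv₁.comp_hasFDerivAt x hL).fun_neg.fun_mul
      ((hasDerivAt_inv hxn).comp_hasFDerivAt x
        (hasStrictFDerivAt_norm_sq x).hasFDerivAt)).congr_fderiv ?_
    ext z
    simp
    ring
  have hsecond := (hk.fun_smul (innerSL ℝ (E := E)).hasFDerivAt).congr_of_eventuallyEq hfd
  rw [InnerProductSpace.laplacian_eq_iteratedFDeriv_stdOrthonormalBasis]
  set e := stdOrthonormalBasis ℝ E
  have hterm : ∀ i, iteratedFDeriv ℝ 2 (fun y : E => v (-Real.log ‖y‖)) x ![e i, e i] =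
      -(v₁ (-Real.log ‖x‖)) * (‖x‖ ^ 2)⁻¹ +
        (w + 2 * v₁ (-Real.log ‖x‖)) * ((‖x‖ ^ 2)⁻¹) ^ 2 * ‖inner ℝ x (e i)‖ ^ 2 := by
    intro i
    rw [iteratedFDeriv_two_apply, hsecond.fderiv]
    have h1 : ∀ c d : E, innerSL ℝ c d = inner ℝ c d := fun _ _ => rfl
    simp [h1]
    ring
  simp only [hterm]
  -- Parseval turns the sum of squared inner products into ‖x‖², so the trace of the Hessian no
  -- longer depends on the basis.
  rw [Finset.sum_add_distrib, ← Finset.mul_sum, ← Finset.mul_sum, e.sum_sq_norm_inner_left]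
  simp
  field_simp
  ring

end Radial

/-! ### The decay kernel and its identification with P -/

theorem continuous_decayKernel (a b : ℝ) : Continuous (decayKernel a b) := by
  unfold decayKernel
  split_ifs <;> fun_prop

theorem decayKernel_pos (a b : ℝ) {t : ℝ} (ht : 0 ≤ t) : 0 < decayKernel a b t := by
  unfold decayKernel
  split_ifs <;> positivity

/-- Translating the decay kernel costs at most a constant factor. -/
theorem decayKernel_add_le {a b t d : ℝ} (ha : 0 < a) (hb : 0 < b) (ht : 0 ≤ t) (hd : 0 ≤ d) :
    decayKernel a b (t + d) ≤ (1 + d) * decayKernel a b t := by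
  have key : ∀ lam : ℝ, 0 ≤ lam → Real.exp (-lam * (t + d)) ≤ Real.exp (-lam * t) := by
    intro lam hlam
    rw [Real.exp_le_exp]
    nlinarith [mul_nonneg hlam hd]
  have key' : ∀ lam : ℝ, 0 ≤ lam → Real.exp (-lam * (t + d)) ≤ (1 + d) * Real.exp (-lam * t) := by
    intro lam hlam
    nlinarith [key lam hlam, mul_nonneg hd (Real.exp_pos (-lam * t)).le]
  unfold decayKernel
  split_ifs
  · refine key' _ ?_
    have : √(a ^ 2 - 4 * b) ≤ a := Real.sqrt_le_iff.2 ⟨ha.le, by linarith⟩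
    linarith
  · calc (1 + (t + d)) * Real.exp (-(a / 2) * (t + d))
        ≤ ((1 + d) * (1 + t)) * Real.exp (-(a / 2) * t) :=
          mul_le_mul (by nlinarith) (key _ (by positivity)) (Real.exp_pos _).le (by positivity)
      _ = _ := by ring
  · exact key' _ (by positivity)

/-- If the forcing does not vanish identically, the homogeneous term is dominated by the
convolution. -/
theorem exists_decayKernel_le_integral {a b τ₀ σ : ℝ} (ha : 0 < a) (hb : 0 < b) (hσ : τ₀ < σ)
    {E : ℝ → ℝ} (hE : ContinuousOn E (Ici τ₀)) (hne : E σ ≠ 0) :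
    ∃ K > 0, ∃ τ₁ ≥ τ₀, ∀ τ ≥ τ₁, decayKernel a b (τ - τ₀) ≤
      K * ∫ s in τ₀..τ, decayKernel a b (τ - s) * |E s| := by
  have hEσ : ContinuousAt (fun s => |E s|) σ := (hE.continuousAt (Ici_mem_nhds hσ)).abs
  have hpos : 0 < |E σ| := abs_pos.2 hne
  obtain ⟨η, hη, hball⟩ := Metric.eventually_nhds_iff.1
    (hEσ.eventually (lt_mem_nhds (half_lt_self hpos)))
  -- On the fixed window [σ, σ'] one has |E| ≥ c, and there the kernel at τ - s is at least the
  -- kernel at τ - τ₀ divided by 1 + B; this window alone gives the lower bound.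
  set c := |E σ| / 2 with hc
  have hc0 : 0 < c := by positivity
  set σ' := σ + η / 2 with hσ'
  set B := σ' - τ₀ with hB
  have hB0 : 0 < B := by linarith
  refine ⟨(1 + B) / (c * (η / 2)), by positivity, σ', by linarith, fun τ hτ => ?_⟩
  have hint : ∀ t₁ t₂, τ₀ ≤ t₁ → t₁ ≤ t₂ → IntervalIntegrable
      (fun s => decayKernel a b (τ - s) * |E s|) MeasureTheory.volume t₁ t₂ := by
    intro t₁ t₂ h1 h2
    refine ContinuousOn.intervalIntegrable ?_
    rw [uIcc_of_le h2]
    exact ((continuous_decayKernel a b).comp (by fun_prop)).continuousOn.mul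
      (hE.abs.mono fun t ht => h1.trans ht.1)
  have hnn : ∀ s ≤ τ, 0 ≤ decayKernel a b (τ - s) * |E s| := fun s hs =>
    mul_nonneg (decayKernel_pos a b (by linarith)).le (abs_nonneg _)
  have h1 : decayKernel a b (τ - τ₀) / (1 + B) * c * (η / 2) ≤
      ∫ s in σ..σ', decayKernel a b (τ - s) * |E s| := by
    have h2 : ∫ _ in σ..σ', decayKernel a b (τ - τ₀) / (1 + B) * c =
        decayKernel a b (τ - τ₀) / (1 + B) * c * (η / 2) := by
      rw [intervalIntegral.integral_const, smul_eq_mul, hσ']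
      ring
    rw [← h2]
    refine intervalIntegral.integral_mono_on (by linarith) (by simp)
      (hint σ σ' hσ.le (by linarith)) fun s hs => ?_
    have h3 : c ≤ |E s| := by
      refine (hball ?_).le
      rw [Real.dist_eq, abs_of_nonneg (by linarith [hs.1])]
      linarith [hs.2]
    have hsτ : 0 ≤ τ - s := by linarith [hs.2]
    have h4 : decayKernel a b (τ - τ₀) ≤ (1 + B) * decayKernel a b (τ - s) := by
      have h5 := decayKernel_add_le ha hb hsτ (show 0 ≤ s - τ₀ by linarith [hs.1])
      rw [show τ - s + (s - τ₀) = τ - τ₀ by ring] at h5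
      refine h5.trans (mul_le_mul_of_nonneg_right ?_ (decayKernel_pos a b hsτ).le)
      linarith [hs.2]
    have h5 : decayKernel a b (τ - τ₀) / (1 + B) ≤ decayKernel a b (τ - s) := by
      rw [div_le_iff₀ (by positivity)]
      linarith
    exact mul_le_mul h5 h3 hc0.le (decayKernel_pos a b hsτ).le
  have h2 : ∫ s in σ..σ', decayKernel a b (τ - s) * |E s| ≤
      ∫ s in τ₀..τ, decayKernel a b (τ - s) * |E s| := by
    rw [← intervalIntegral.integral_add_adjacent_intervals (hint τ₀ σ le_rfl hσ.le)
      (hint σ τ hσ.le (by linarith)), ← intervalIntegral.integral_add_adjacent_intervals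
      (hint σ σ' hσ.le (by linarith)) (hint σ' τ (by linarith) hτ)]
    have h3 : 0 ≤ ∫ s in τ₀..σ, decayKernel a b (τ - s) * |E s| :=
      intervalIntegral.integral_nonneg hσ.le fun s hs => hnn s (by linarith [hs.2])
    have h4 : 0 ≤ ∫ s in σ'..τ, decayKernel a b (τ - s) * |E s| :=
      intervalIntegral.integral_nonneg hτ fun s hs => hnn s hs.2
    linarith
  have h3 := h1.trans h2
  rw [div_mul_eq_mul_div, le_div_iff₀ (by positivity)]
  rw [div_mul_eq_mul_div, div_mul_eq_mul_div, div_le_iff₀ (by positivity)] at h3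
  linarith

theorem sqrt_pred_facts {N : ℕ} (hN : 3 ≤ N) :
    √((N : ℝ) - 1) ^ 2 = N - 1 ∧ 0 < (N : ℝ) - 4 + 2 * √((N : ℝ) - 1) := by
  have hN' : (3 : ℝ) ≤ N := by exact_mod_cast hN
  refine ⟨Real.sq_sqrt (by linarith), ?_⟩
  have : 1 < √((N : ℝ) - 1) := Real.lt_sqrt_of_sq_lt (by linarith)
  linarith

/-- Since b = N - 2 - a, the discriminant a² - 4b equals (a+2)² - 4(N-1). Its only factor of
variable sign is a + 2 - 2√(N-1) = 4/(p-1) - 4/(p_* - 1). -/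
theorem four_mul_coeffB_lt_iff {N : ℕ} (hN : 3 ≤ N) {p q : ℝ} (hp : 1 < p)
    (hq : q - 1 = 1 / (p - 1)) (ha : 0 < coeffA N p) :
    (4 * coeffB N q < coeffA N p ^ 2 ↔ p < pStar N) ∧
      (coeffA N p ^ 2 = 4 * coeffB N q ↔ p = pStar N) := by
  obtain ⟨hr2, hd⟩ := sqrt_pred_facts hN
  have hr := Real.sqrt_nonneg ((N : ℝ) - 1)
  set r := √((N : ℝ) - 1)
  set d := (N : ℝ) - 4 + 2 * r with hdd
  have hp' : 0 < p - 1 := by linarith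
  have hA : coeffA N p = 4 / (p - 1) - N + 2 := rfl
  have hB : coeffB N q = N - 2 - coeffA N p := by
    rw [coeffB, hA, show q = 1 + 1 / (p - 1) by linarith]
    ring
  have hS : pStar N = 1 + 4 / d := rfl
  have hfac : coeffA N p ^ 2 - 4 * coeffB N q =
      (coeffA N p + 2 - 2 * r) * (coeffA N p + 2 + 2 * r) := by
    rw [hB]
    linear_combination 4 * hr2
  have hpos : 0 < coeffA N p + 2 + 2 * r := by linarith
  have hlin : coeffA N p + 2 - 2 * r = 4 / (p - 1) - d := by rw [hA, hdd]; ring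
  constructor
  · rw [← sub_pos, hfac, mul_pos_iff_of_pos_right hpos, hlin, sub_pos, hS, ← sub_lt_iff_lt_add',
      lt_div_comm₀ hd hp']
  · rw [← sub_eq_zero, hfac, mul_eq_zero_iff_right hpos.ne', hlin, sub_eq_zero, hS,
      show p = 1 + 4 / d ↔ p - 1 = 4 / d from ⟨fun h => by linarith, fun h => by linarith⟩,
      div_eq_iff hp'.ne', eq_div_iff hd.ne']
    constructor <;> intro h <;> linarith

/-- Powers of r/s become exponentials in τ - σ and log(s/r) becomes τ - σ. The three ranges of p
match the sign of the discriminant, with λ_* = a/2 at p = p_*. -/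
theorem P_exp_eq_decayKernel {N : ℕ} (hN : 3 ≤ N) {p q : ℝ} (hp : 1 < p)
    (hq : q - 1 = 1 / (p - 1)) (ha : 0 < coeffA N p) (τ σ : ℝ) :
    P N p q (Real.exp (-τ)) (Real.exp (-σ)) =
      decayKernel (coeffA N p) (coeffB N q) (τ - σ) := by
  obtain ⟨h1, h2⟩ := four_mul_coeffB_lt_iff hN hp hq ha
  have hdiv : Real.exp (-τ) / Real.exp (-σ) = Real.exp (-(τ - σ)) := by
    rw [← Real.exp_sub]
    ring_nf
  have hdiv' : Real.exp (-σ) / Real.exp (-τ) = Real.exp (τ - σ) := by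
    rw [← Real.exp_sub]
    ring_nf
  have hpow : ∀ y : ℝ, Real.exp (-(τ - σ)) ^ y = Real.exp (-y * (τ - σ)) := fun y => by
    rw [← Real.exp_mul]
    ring_nf
  rw [P, decayKernel, hdiv, hdiv', Real.log_exp, hpow, hpow, hpow]
  simp only [h1, h2]
  refine if_congr Iff.rfl rfl ?_
  split_ifs with h
  · have : lambdaStar N = coeffA N p / 2 := by
      rw [lambdaStar, coeffA, ← h]
      ring
    rw [this]
  · rfl

theorem errorIntegral_exp {N : ℕ} (hN : 3 ≤ N) (f : ℝ → ℝ) {p q : ℝ} (hp : 1 < p)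
    (hq : q - 1 = 1 / (p - 1)) (ha : 0 < coeffA N p) (τ₀ τ : ℝ) :
    errorIntegral N f p q (Real.exp (-τ₀)) (Real.exp (-τ)) =
      ∫ s in τ₀..τ, decayKernel (coeffA N p) (coeffB N q) (τ - s) *
        |errE f q (logProfile N f q s)| := by
  rw [errorIntegral, ← intervalIntegral.integral_comp_mul_deriv_of_deriv_nonpos
    (f := fun σ : ℝ => Real.exp (-σ)) (f' := fun σ => -Real.exp (-σ)) (by fun_prop)
    (fun x _ => ((hasDerivAt_neg x).exp).congr_deriv (by ring))
    (fun x _ => by linarith [Real.exp_pos (-x)]), intervalIntegral.integral_symm,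
    ← intervalIntegral.integral_neg]
  refine intervalIntegral.integral_congr fun σ _ => ?_
  simp only [Function.comp_apply]
  rw [P_exp_eq_decayKernel hN hp hq ha, errE, logProfile]
  have := (Real.exp_pos (-σ)).ne'
  field_simp

/-! ### Regularity and return to the punctured ball -/

/-- A solution of an autonomous scalar equation with `C¹` right-hand side is `C²`. -/
theorem contDiffOn_two_of_autonomous {φ U : ℝ → ℝ} {s t : Set ℝ} (hs : IsOpen s)
    (hφ : ContDiffOn ℝ 1 φ t) (hU : ∀ τ ∈ s, HasDerivAt U (φ (U τ)) τ) (hmap : MapsTo U s t) :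
    ContDiffOn ℝ 2 U s := by
  have hd : DifferentiableOn ℝ U s := fun τ hτ => (hU τ hτ).differentiableAt.differentiableWithinAt
  have hderiv : ∀ τ ∈ s, deriv U τ = φ (U τ) := fun τ hτ => (hU τ hτ).deriv
  have h1 : ContDiffOn ℝ 1 U s := by
    rw [show (1 : WithTop ℕ∞) = 0 + 1 by rfl, contDiffOn_succ_iff_deriv_of_isOpen hs]
    refine ⟨hd, by simp, contDiffOn_zero.2 ?_⟩
    exact (hφ.continuousOn.comp hd.continuousOn hmap).congr hderiv
  rw [show (2 : WithTop ℕ∞) = 1 + 1 by norm_num, contDiffOn_succ_iff_deriv_of_isOpen hs]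
  exact ⟨hd, by simp, (hφ.comp h1 hmap).congr hderiv⟩

/-- A solution of a second order linear equation with continuous forcing is `C²`. -/
theorem contDiff_two_of_linear {a b : ℝ} {θ y n : ℝ → ℝ} (hθ : ∀ τ, HasDerivAt θ (y τ) τ)
    (hy : ∀ τ, HasDerivAt y (-a * y τ - b * θ τ + n τ) τ) (hn : Continuous n) :
    ContDiff ℝ 2 θ ∧ ContDiff ℝ 1 y := by
  have hθc : Continuous θ := continuous_iff_continuousAt.2 fun τ => (hθ τ).continuousAt
  have hyc : Continuous y := continuous_iff_continuousAt.2 fun τ => (hy τ).continuousAt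
  have h1 : ContDiff ℝ 1 y := by
    rw [contDiff_one_iff_deriv]
    refine ⟨fun τ => (hy τ).differentiableAt, ?_⟩
    rw [show deriv y = fun τ => -a * y τ - b * θ τ + n τ from funext fun τ => (hy τ).deriv]
    fun_prop
  refine ⟨?_, h1⟩
  rw [show (2 : WithTop ℕ∞) = 1 + 1 by norm_num, contDiff_succ_iff_deriv]
  refine ⟨fun τ => (hθ τ).differentiableAt, by simp, ?_⟩
  rwa [show deriv θ = y from funext fun τ => (hθ τ).deriv]

namespace IsSuperlinear

variable {f : ℝ → ℝ} {p q : ℝ}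

theorem contDiffOn_logProfile (h : IsSuperlinear f p q) {N : ℕ} {s : Set ℝ} (hs : IsOpen s)
    (hU : ∀ τ ∈ s, 0 < logProfile N f q τ ∧ HasDerivAt (logProfile N f q)
      (2 * F f (logProfile N f q τ) * f (logProfile N f q τ)) τ) :
    ContDiffOn ℝ 2 (logProfile N f q) s :=
  contDiffOn_two_of_autonomous (φ := fun u => 2 * F f u * f u) (t := Ioi 0) hs
    ((contDiffOn_const.mul h.contDiffOn_F).mul (h.contDiffOn.of_le (by norm_num)))
    (fun τ hτ => (hU τ hτ).2) fun τ hτ => (hU τ hτ).1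

/-- A correction in logarithmic variables gives a radial singular solution. -/
theorem isSingularSolution_of_log (h : IsSuperlinear f p q) {N : ℕ}
    (hb : 0 < coeffB N q) {τ₀ : ℝ} {θ y n : ℝ → ℝ}
    (hU : ∀ τ ≥ τ₀, 0 < logProfile N f q τ ∧
      F f (logProfile N f q τ) = Real.exp (-τ) ^ 2 / coeffB N q ∧
      HasDerivAt (logProfile N f q)
        (2 * F f (logProfile N f q τ) * f (logProfile N f q τ)) τ)
    (hθ : ∀ τ, HasDerivAt θ (y τ) τ)
    (hy : ∀ τ, HasDerivAt y (-(4 * q - N - 2) * y τ - coeffB N q * θ τ + n τ) τ)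
    (hnc : Continuous n)
    (hn : ∀ τ ≥ τ₀, n τ = perturbation f p q (coeffB N q) (logProfile N f q τ) (θ τ) (y τ) ∧
      |θ τ| ≤ 1 / 2) :
    IsSingularSolution N f (Real.exp (-τ₀))
      (fun x => uTilde N f q ‖x‖ * (1 + θ (-Real.log ‖x‖))) := by
  set U := logProfile N f q with hUdef
  set v : ℝ → ℝ := fun t => U t * (1 + θ t) with hv
  have hueq : ∀ x : EuclideanSpace ℝ (Fin N), x ≠ 0 →
      uTilde N f q ‖x‖ * (1 + θ (-Real.log ‖x‖)) = v (-Real.log ‖x‖) := fun x hx => by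
    simp only [hv, hUdef, logProfile]
    rw [neg_neg, Real.exp_log (norm_pos_iff.2 hx)]
  have hlog : ∀ x ∈ puncturedBall N (Real.exp (-τ₀)), x ≠ 0 ∧ τ₀ < -Real.log ‖x‖ := by
    intro x hx
    have hx0 : x ≠ 0 := hx.2
    have hx1 : ‖x‖ < Real.exp (-τ₀) := by simpa using hx.1
    have := (Real.log_lt_iff_lt_exp (norm_pos_iff.2 hx0)).2 hx1
    exact ⟨hx0, by linarith⟩
  have h1θ : ∀ τ ≥ τ₀, 1 / 2 ≤ 1 + θ τ := fun τ hτ => by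
    have := (abs_le.1 (hn τ hτ).2).1
    linarith
  have hvpos : ∀ τ ≥ τ₀, 0 < v τ := fun τ hτ =>
    mul_pos (hU τ hτ).1 (by linarith [h1θ τ hτ])
  have hvC : ContDiffOn ℝ 2 v (Ioi τ₀) :=
    (h.contDiffOn_logProfile isOpen_Ioi fun τ hτ =>
      ⟨(hU τ (le_of_lt hτ)).1, (hU τ (le_of_lt hτ)).2.2⟩).mul
      (contDiff_const.add (contDiff_two_of_linear hθ hy hnc).1).contDiffOn
  have hopen : IsOpen (puncturedBall N (Real.exp (-τ₀))) :=
    Metric.isOpen_ball.sdiff isClosed_singleton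
  refine ⟨?_, ?_, ?_, ?_⟩
  · refine ContDiffOn.congr (f := v ∘ fun x => -Real.log ‖x‖) ?_ fun x hx => hueq x (hlog x hx).1
    refine hvC.comp (fun x hx => ?_) fun x hx => (hlog x hx).2
    have hx0 := (hlog x hx).1
    exact ((contDiffAt_norm ℝ hx0).log (norm_ne_zero_iff.2 hx0)).neg.contDiffWithinAt
  · intro x hx
    obtain ⟨hx0, hx1⟩ := hlog x hx
    rw [hueq x hx0]
    exact hvpos _ hx1.le
  · intro x hx
    obtain ⟨hx0, hx1⟩ := hlog x hx
    set τ := -Real.log ‖x‖ with hτ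
    have hstep : ∀ t > τ₀, _ := fun t (ht : t > τ₀) => h.hasDerivAt_corrected hb (hU t ht.le).1
      (hU t ht.le).2.1 (hU t ht.le).2.2 (hθ t) (hy t) (hn t ht.le).1
    obtain ⟨-, w, hw, heq⟩ := hstep τ hx1
    have hlap := laplacian_comp_neg_log_norm (v := v) hx0
      (eventually_of_mem (Ioi_mem_nhds hx1) fun t ht => (hstep t ht).1) hw
    have hcongr : (fun x : EuclideanSpace ℝ (Fin N) =>
        uTilde N f q ‖x‖ * (1 + θ (-Real.log ‖x‖))) =ᶠ[𝓝 x] fun x => v (-Real.log ‖x‖) := by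
      filter_upwards [isOpen_ne.mem_nhds hx0] with z hz using hueq z hz
    rw [(InnerProductSpace.laplacian_congr_nhds hcongr).self_of_nhds, hlap, hueq x hx0,
      finrank_euclideanSpace_fin]
    have hexp : Real.exp (-τ) = ‖x‖ := by rw [hτ, neg_neg, Real.exp_log (norm_pos_iff.2 hx0)]
    have hxn : ‖x‖ ^ 2 ≠ 0 := by simpa using hx0
    rw [hexp] at heq
    rw [← hτ, neg_eq_iff_eq_neg, div_eq_iff hxn]
    simp only [hv]
    linarith
  · have hL : Tendsto (fun x : EuclideanSpace ℝ (Fin N) => -Real.log ‖x‖) (𝓝[≠] 0) atTop :=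
      tendsto_neg_atBot_atTop.comp (Real.tendsto_log_nhdsGT_zero.comp tendsto_norm_nhdsNE_zero)
    -- Since |θ| ≤ 1/2, the solution is at least half the profile.
    have hvt : Tendsto v atTop atTop := by
      refine tendsto_atTop_mono' _ ?_
        ((h.tendsto_logProfile hb).atTop_mul_const (show (0 : ℝ) < 1 / 2 by norm_num))
      filter_upwards [eventually_ge_atTop τ₀] with τ hτ
      exact mul_le_mul_of_nonneg_left (h1θ τ hτ) (hU τ hτ).1.le
    refine (hvt.comp hL).congr' ?_
    filter_upwards [self_mem_nhdsWithin] with x hx using (hueq x hx).symm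

end IsSuperlinear

/-- The window for p reads (N-2)/4 < q - 1 < (N-2)/2, whose two halves are a > 0 and b > 0. The last
bound holds because a/2 = 2(q-1) - (N-2)/2. -/
theorem exponent_facts {N : ℕ} (hN : 3 ≤ N) {p q : ℝ} (hpq : 1 / p + 1 / q = 1)
    (hp_c : pCrit N < p) (hp_S : p < pSob N) :
    1 < p ∧ q - 1 = 1 / (p - 1) ∧ coeffA N p = 4 * q - N - 2 ∧ 0 < coeffA N p ∧
      0 < coeffB N q ∧ coeffA N p / 2 < 2 * (q - 1) := by
  have hN' : (3 : ℝ) ≤ N := by exact_mod_cast hN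
  have hN2 : (0 : ℝ) < N - 2 := by linarith
  rw [pCrit, div_lt_iff₀ hN2] at hp_c
  rw [pSob, lt_div_iff₀ hN2] at hp_S
  have hp : 1 < p := by
    by_contra! hp
    nlinarith
  have hp0 : p ≠ 0 := by linarith
  have hp1 : 0 < p - 1 := by linarith
  have hq : q - 1 = 1 / (p - 1) := by
    have hq0 : q ≠ 0 := by
      rintro rfl
      rw [div_zero, add_zero, div_eq_one_iff_eq hp0] at hpq
      linarith
    field_simp at hpq ⊢
    linarith
  have hA : coeffA N p = 4 * q - N - 2 := by
    rw [coeffA, show q = 1 + 1 / (p - 1) by linarith]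
    ring
  have hlow : ((N : ℝ) - 2) / 4 < q - 1 := by
    rw [hq, div_lt_div_iff₀ (by norm_num) hp1]
    linarith
  have hupp : q - 1 < ((N : ℝ) - 2) / 2 := by
    rw [hq, div_lt_div_iff₀ hp1 (by norm_num)]
    linarith
  refine ⟨hp, hq, hA, ?_, ?_, ?_⟩
  · rw [hA]; linarith
  · rw [coeffB]; linarith
  · rw [hA]; linarith

/-- If every prescribed small boundary value of the correction is attained, there are infinitely
many radial singular solutions. -/
theorem infinite_of_boundary_values {N : ℕ} (hN : 0 < N) {f : ℝ → ℝ} {q r₀ ε : ℝ} (hr₀ : 0 < r₀)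
    (hε : 0 < ε)
    (hex : ∀ α > 0, ∀ β > 0, α + β < ε → ∃ θ : ℝ → ℝ, ContDiffOn ℝ 1 θ (Ioc 0 r₀) ∧ θ r₀ = α ∧
      IsSingularSolution N f r₀ (fun x => uTilde N f q ‖x‖ * (1 + θ ‖x‖))) :
    Set.Infinite ((fun u : EuclideanSpace ℝ (Fin N) → ℝ => (puncturedBall N r₀).domRestrict u) ''
      {u | IsSingularSolution N f r₀ u ∧ IsRadial N r₀ u}) := by
  have hex' : ∀ α : ℝ, ∃ θ : ℝ → ℝ, α ∈ Ioo 0 (ε / 2) → ContDiffOn ℝ 1 θ (Ioc 0 r₀) ∧ θ r₀ = α ∧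
      IsSingularSolution N f r₀ (fun x => uTilde N f q ‖x‖ * (1 + θ ‖x‖)) := by
    intro α
    by_cases hα : α ∈ Ioo 0 (ε / 2)
    · obtain ⟨θ, hθ⟩ := hex α hα.1 (ε / 4) (by positivity) (by linarith [hα.2])
      exact ⟨θ, fun _ => hθ⟩
    · exact ⟨0, fun h => absurd h hα⟩
  choose Θ hΘ using hex'
  refine Set.infinite_of_injOn_mapsTo (s := Ioo 0 (ε / 2)) (f := fun α =>
    (puncturedBall N r₀).domRestrict (fun x => uTilde N f q ‖x‖ * (1 + Θ α ‖x‖))) ?_ ?_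
    (Ioo_infinite (by positivity))
  · intro α hα α' hα' heq
    obtain ⟨hc, h0, hs⟩ := hΘ α hα
    obtain ⟨hc', h0', -⟩ := hΘ α' hα'
    -- The open ball does not see r₀: the corrections are compared inside, after dividing by the
    -- nonzero profile, and continuity up to r₀ then recovers α = α'.
    have hon : EqOn (Θ α) (Θ α') (Ioo 0 r₀) := by
      intro r hr
      set x : EuclideanSpace ℝ (Fin N) := EuclideanSpace.single ⟨0, hN⟩ r
      have hxn : ‖x‖ = r := by simp [x, abs_of_pos hr.1]
      have hx : x ∈ puncturedBall N r₀ := by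
        refine ⟨by simpa [hxn] using hr.2, fun h => ?_⟩
        rw [mem_singleton_iff] at h
        rw [h, norm_zero] at hxn
        exact hr.1.ne hxn
      have h1 := congrFun heq ⟨x, hx⟩
      have h2 := hs.pos x hx
      simp only [Set.domRestrict_apply, hxn] at h1 h2
      have h3 : uTilde N f q r ≠ 0 := fun h => by simp [h] at h2
      have := mul_left_cancel₀ h3 h1
      linarith
    have hmem : r₀ ∈ Ioc 0 r₀ := ⟨hr₀, le_rfl⟩
    have hne : (𝓝[Ioo 0 r₀] r₀).NeBot := by
      rw [nhdsWithin_Ioo_eq_nhdsLT hr₀]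
      infer_instance
    have ht := (hc.continuousOn r₀ hmem).mono Ioo_subset_Ioc_self
    have ht' := (hc'.continuousOn r₀ hmem).mono Ioo_subset_Ioc_self
    have := tendsto_nhds_unique_of_eventuallyEq ht ht'
      (eventually_of_mem self_mem_nhdsWithin fun r hr => hon hr)
    rw [← h0, ← h0', this]
  · intro α hα
    refine ⟨_, ⟨(hΘ α hα).2.2, fun x _ z _ hxz => ?_⟩, rfl⟩
    simp only [hxz]

end SingularSolutions

/-! ### The main theorem -/

theorem theorem1p1 (N : ℕ) (hN : 3 ≤ N) (f : ℝ → ℝ) (p q : ℝ)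
    (hf : ContDiffOn ℝ 2 f (Ioi 0))
    (hf_pos : ∀ s, 0 < s → 0 < f s)
    (hf'_pos : ∀ s, 0 < s → 0 < deriv f s)
    (hq : Tendsto (fun s => deriv f s ^ 2 / (f s * deriv (deriv f) s)) atTop (𝓝 q))
    (hpq : 1 / p + 1 / q = 1)
    (hp_c : SingularSolutions.pCrit N < p)
    (hp_S : p < SingularSolutions.pSob N) :
    -- `F` is well defined on `(0,∞)` and one-to-one there
    (∀ s, 0 < s → MeasureTheory.IntegrableOn (fun t => 1 / f t) (Ioi s)) ∧
    InjOn (SingularSolutions.F f) (Ioi 0) ∧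
    ∃ r₀ > 0, ∃ ε > 0,
      -- `ũ = F⁻¹(r² / (2N - 4q))` is well defined on `(0, r₀]`
      (∀ r ∈ Ioc 0 r₀,
        r ^ 2 / (2 * (N : ℝ) - 4 * q) ∈ SingularSolutions.F f '' Ioi 0) ∧
      (∀ α > 0, ∀ β > 0, α + β < ε →
        ∃ θ : ℝ → ℝ,
          ContDiffOn ℝ 2 θ (Ioo 0 r₀) ∧
          ContDiffOn ℝ 1 θ (Ioc 0 r₀) ∧
          Tendsto θ (𝓝[>] 0) (𝓝 0) ∧
          θ r₀ = α ∧
          r₀ * derivWithin θ (Ioc 0 r₀) r₀ = -β ∧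
          SingularSolutions.IsSingularSolution N f r₀
            (fun x => SingularSolutions.uTilde N f q ‖x‖ * (1 + θ ‖x‖)) ∧
          (fun r => |θ r| + r * |deriv θ r|) =O[𝓝[>] 0]
            (fun r => SingularSolutions.P N p q r r₀ +
              SingularSolutions.errorIntegral N f p q r₀ r) ∧
          ((∃ s ∈ Ioo 0 r₀,
              deriv f (SingularSolutions.uTilde N f q s) *
                SingularSolutions.F f (SingularSolutions.uTilde N f q s) ≠ q) →
            (fun r => |θ r| + r * |deriv θ r|) =O[𝓝[>] 0]
              (fun r => SingularSolutions.errorIntegral N f p q r₀ r))) ∧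
      -- infinitely many singular solutions, already as functions on the punctured ball
      Set.Infinite
        ((fun u : EuclideanSpace ℝ (Fin N) → ℝ =>
            (SingularSolutions.puncturedBall N r₀).domRestrict u) ''
          {u | SingularSolutions.IsSingularSolution N f r₀ u ∧
            SingularSolutions.IsRadial N r₀ u}) := by
  obtain ⟨hp, hq1, hA, ha, hb, haq⟩ := SingularSolutions.exponent_facts hN hpq hp_c hp_S
  have h : SingularSolutions.IsSuperlinear f p q := ⟨hf, hf_pos, hf'_pos, hq, hpq, hp⟩
  refine ⟨fun s hs => h.integrableOn hs, h.strictAntiOn_F.injOn, ?_⟩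
  obtain ⟨τ₀, ε, hε, hU, hsol⟩ := h.exists_log_correction (N := N) ha hb haq
  have hU' : ∀ τ ≥ τ₀, _ := fun τ (hτ : τ ≥ τ₀) => hU τ (by linarith)
  have hr₀ : 0 < Real.exp (-τ₀) := Real.exp_pos _
  have hloge : -Real.log (Real.exp (-τ₀)) = τ₀ := by rw [Real.log_exp, neg_neg]
  have hmain : ∀ α > 0, ∀ β > 0, α + β < ε → ∃ θ : ℝ → ℝ,
      ContDiffOn ℝ 2 θ (Ioo 0 (Real.exp (-τ₀))) ∧
      ContDiffOn ℝ 1 θ (Ioc 0 (Real.exp (-τ₀))) ∧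
      Tendsto θ (𝓝[>] 0) (𝓝 0) ∧
      θ (Real.exp (-τ₀)) = α ∧
      Real.exp (-τ₀) * derivWithin θ (Ioc 0 (Real.exp (-τ₀))) (Real.exp (-τ₀)) = -β ∧
      SingularSolutions.IsSingularSolution N f (Real.exp (-τ₀))
        (fun x => SingularSolutions.uTilde N f q ‖x‖ * (1 + θ ‖x‖)) ∧
      (fun r => |θ r| + r * |deriv θ r|) =O[𝓝[>] 0]
        (fun r => SingularSolutions.P N p q r (Real.exp (-τ₀)) +
          SingularSolutions.errorIntegral N f p q (Real.exp (-τ₀)) r) ∧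
      ((∃ s ∈ Ioo 0 (Real.exp (-τ₀)),
          deriv f (SingularSolutions.uTilde N f q s) *
            SingularSolutions.F f (SingularSolutions.uTilde N f q s) ≠ q) →
        (fun r => |θ r| + r * |deriv θ r|) =O[𝓝[>] 0]
          (fun r => SingularSolutions.errorIntegral N f p q (Real.exp (-τ₀)) r)) := by
    intro α hα β hβ hαβ
    obtain ⟨θ, y, n, hn, hθ0, hy0, hθ, hy, hnl, hlim, K, hK, τ₁, hτ₁, hdec⟩ :=
      hsol α β (by rwa [abs_of_pos hα, abs_of_pos hβ])
    obtain ⟨hθC, -⟩ := SingularSolutions.contDiff_two_of_linear hθ hy hn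
    have hderiv : ∀ r > 0, HasDerivAt (fun r => θ (-Real.log r)) (-(y (-Real.log r) / r)) r := by
      intro r hr
      refine ((hθ (-Real.log r)).comp r (Real.hasDerivAt_log (ne_of_gt hr)).neg).congr_deriv ?_
      ring
    have hC2 : ContDiffOn ℝ 2 (fun r => θ (-Real.log r)) (Ioi 0) := fun r hr =>
      (hθC.contDiffAt.comp r (Real.contDiffAt_log.2 (ne_of_gt hr)).neg).contDiffWithinAt
    have hL : Tendsto (fun r : ℝ => -Real.log r) (𝓝[>] 0) atTop :=
      tendsto_neg_atBot_atTop.comp Real.tendsto_log_nhdsGT_zero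
    -- Since d/dτ = -r d/dr, the quantity r|θ'(r)| is |y(-log r)|, so every bound in τ transfers to
    -- r. The same sign turns y(τ₀) = β into the boundary slope -β.
    have hreduce : ∀ {g : ℝ → ℝ} {K' τ₂ : ℝ},
        (∀ τ ≥ τ₂, |θ τ| + |y τ| ≤ K' * g (Real.exp (-τ))) →
        (fun r => |θ (-Real.log r)| + r * |deriv (fun r => θ (-Real.log r)) r|) =O[𝓝[>] 0] g := by
      intro g K' τ₂ hg
      refine IsBigO.of_bound |K'| ?_
      filter_upwards [hL.eventually_ge_atTop τ₂, self_mem_nhdsWithin] with r hr hr0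
      have hr0' : 0 < r := hr0
      have h1 := hg _ hr
      rw [neg_neg, Real.exp_log hr0'] at h1
      rw [(hderiv r hr0').deriv, abs_neg, abs_div, abs_of_pos hr0', mul_div_cancel₀ _ hr0'.ne',
        Real.norm_eq_abs, abs_of_nonneg (by positivity), Real.norm_eq_abs, ← abs_mul]
      exact h1.trans (le_abs_self _)
    have hE : ContinuousOn (fun τ => SingularSolutions.errE f q
        (SingularSolutions.logProfile N f q τ)) (Ici τ₀) :=
      h.continuousOn_errE.comp
        (fun τ hτ => (hU' τ hτ).2.2.continuousAt.continuousWithinAt) fun τ hτ => (hU' τ hτ).1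
    refine ⟨fun r => θ (-Real.log r), hC2.mono Ioo_subset_Ioi_self,
      (hC2.of_le (by norm_num)).mono Ioc_subset_Ioi_self, ?_, ?_, ?_, ?_, ?_, ?_⟩
    · refine squeeze_zero_norm' (Eventually.of_forall fun r => ?_) (hlim.comp hL)
      exact le_add_of_nonneg_right (abs_nonneg _)
    · simp only [hloge, hθ0]
    · rw [(hderiv _ hr₀).hasDerivWithinAt.derivWithin
        (uniqueDiffOn_Ioc _ _ _ ⟨hr₀, le_rfl⟩), hloge, hy0]
      field_simp
    · exact h.isSingularSolution_of_log hb hU' hθ (by rwa [hA] at hy) hn hnl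
    · refine hreduce (τ₂ := τ₁) (K' := K) fun τ hτ => ?_
      rw [SingularSolutions.P_exp_eq_decayKernel hN hp hq1 ha,
        SingularSolutions.errorIntegral_exp hN f hp hq1 ha]
      exact hdec τ hτ
    · rintro ⟨s, hs, hne⟩
      have hσ : τ₀ < -Real.log s := by
        have := (Real.log_lt_iff_lt_exp hs.1).2 hs.2
        linarith
      obtain ⟨K₂, hK₂, τ₂, -, hker⟩ := SingularSolutions.exists_decayKernel_le_integral ha hb hσ hE
        (by
          rw [SingularSolutions.errE, SingularSolutions.logProfile, neg_neg, Real.exp_log hs.1]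
          exact sub_ne_zero.2 hne)
      refine hreduce (τ₂ := max τ₁ τ₂) (K' := K * (K₂ + 1)) fun τ hτ => ?_
      rw [SingularSolutions.errorIntegral_exp hN f hp hq1 ha]
      have h1 := hdec τ ((le_max_left _ _).trans hτ)
      have h2 := mul_le_mul_of_nonneg_left (hker τ ((le_max_right _ _).trans hτ)) hK.le
      linarith
  refine ⟨Real.exp (-τ₀), hr₀, ε, hε, ?_, hmain, ?_⟩
  · intro r hr
    have hτ : -Real.log r ≥ τ₀ := by
      have := (Real.log_le_iff_le_exp hr.1).2 hr.2
      linarith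
    obtain ⟨h1, h2, -⟩ := hU' _ hτ
    rw [neg_neg, Real.exp_log hr.1] at h2
    exact ⟨_, h1, h2⟩
  · refine SingularSolutions.infinite_of_boundary_values (q := q) (by omega) hr₀ hε ?_
    intro α hα β hβ hαβ
    obtain ⟨θ, -, h2, -, h4, -, h6, -, -⟩ := hmain α hα β hβ hαβ
    exact ⟨θ, h2, h4, h6⟩
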